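/- Let $\Theta$ be a connected simplicial graph without vertices of degree $1$, let $\Omega$ be a simplicial graph (not necessarily connected, finite or locally finite) with connected components $\Omega_i$, and let $f\colon\Omega\to\Theta$ be a graph homomorphism. An immersed cycle in $\Omega$ is a locally injective map $C\to\Omega$ from a cycle graph. Assume that every edge of $\Omega$ is traversed by some immersed cycle in $\Omega$ (when all $\Omega_i$ are finite, this holds in particular if $\Omega$ has no vertices of degree $1$). The graphical complex $X=X_{(\Omega,\Theta)}$ is the $2$-complex with $1$-skeleton $\Theta$ obtained by attaching a $2$-cell along $C\to\Omega\to\Theta$ for every immersed cycle $C\to\Omega$. A piece of $X$ is an immersed nontrivial path $P\to\Theta$ that has two distinct lifts $P\to\Omega$. A disc diagram is a combinatorial map $D\to X$, where $D$ is obtained from a combinatorial cell structure on $S^2$ by removing one open $2$-cell. Every $2$-cell $R$ of $D$ comes with an immersed cycle $\partial R\to\Omega$ whose composition with $f$ is $\partial R\to D\to X$. A piece of $D$ is an immersed nontrivial path $P\to D$ that factors in two distinct ways as $P\to\partial R_m\to D$ and $P\to\partial R_n\to D$ through $2$-cells of $D$. The diagram is reduced if for every such piece of $D$ the path $P\to D\to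 X$ is a piece of $X$ by the two induced lifts, i.e. it is immersed and the lifts $P\to\partial R_m\to\Omega$ and $P\to\partial R_n\to\Omega$ are distinct. The complex $X$ satisfies $C(p)$ if there is no immersed cycle $C\to\Omega$ such that $C\to\Omega\to\Theta$ is a concatenation of fewer than $p$ pieces, and it satisfies $T(q)$ if no reduced disc diagram $D\to X$ has an interior vertex of degree greater than $2$ and less than $q$. The thickening $\mathrm{Th}(X)$ is the flag completion of the graph obtained from $\Theta$ by adding all edges between distinct vertices of the image of $\Omega_i$, for every $i$. A graph is bridged if it is connected and all its isometric cycles have length $3$, and a flag simplicial complex is systolic if its $1$-skeleton is bridged. Proposition. If $X$ is simply connected and satisfies $C(3)$ and $T(6)$, then $\mathrm{Th}(X)$ is systolic. -/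

import Mathlib

/-! ### Bridged graphs and systolic complexes -/

/-- A (connected) graph is bridged if all its isometric cycles have length `3`. -/
def IsBridged {V : Type*} (G : SimpleGraph V) : Prop :=
  G.Connected ∧ ∀ (n : ℕ), 3 ≤ n → ∀ c : SimpleGraph.cycleGraph n →g G,
    (∀ i j, G.dist (c i) (c j) = (SimpleGraph.cycleGraph n).dist i j) → n = 3

/-- The `1`-skeleton of a simplicial complex. -/
def oneSkeleton {V : Type*} (K : AbstractSimplicialComplex V) : SimpleGraph V where
  Adj u v := u ≠ v ∧ ∃ s ∈ K.faces, u ∈ s ∧ v ∈ s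
  symm := ⟨fun _ _ h => ⟨h.1.symm, h.2.imp fun _ hs => ⟨hs.1, hs.2.2, hs.2.1⟩⟩⟩
  loopless := ⟨fun _ h => h.1 rfl⟩

/-- A simplicial complex is flag if every nonempty finite set of pairwise adjacent vertices
spans a simplex. -/
def IsFlag {V : Type*} (K : AbstractSimplicialComplex V) : Prop :=
  ∀ s : Finset V, s.Nonempty → (oneSkeleton K).IsClique (s : Set V) → s ∈ K.faces

/-- A flag simplicial complex is systolic if its `1`-skeleton is a bridged graph. -/
def IsSystolic {V : Type*} (K : AbstractSimplicialComplex V) : Prop :=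
  IsFlag K ∧ IsBridged (oneSkeleton K)

/-- The flag completion of a graph: its simplices are the nonempty finite cliques. -/
def flagCompletion {V : Type*} (G : SimpleGraph V) : AbstractSimplicialComplex V where
  faces := {s | s.Nonempty ∧ G.IsClique (s : Set V)}
  isRelLowerSet_faces := fun _ h =>
    ⟨h.1, fun _ hts ht => ⟨ht, h.2.subset (Finset.coe_subset.mpr hts)⟩⟩
  singleton_mem := fun v => ⟨Finset.singleton_nonempty v, by simp⟩

namespace Graphical

/-! ### Paths, immersed cycles, homotopy in a graphical complex

A graph homomorphism `f : Ω →g Θ` determines the graphical complex `X`: its `1`-skeleton is `Θ`,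
and it has a `2`-cell attached along `C → Ω → Θ` for every immersed cycle `C → Ω`. -/

/-- Immersed (locally injective) edge paths, as lists of successive vertices: no backtracking. -/
def NoBacktrack {V : Type*} (l : List V) : Prop :=
  ∀ (i : ℕ) (h : i + 2 < l.length), l[i] ≠ l[i + 2]

/-- A closed walk is an immersed cycle if it is nontrivial and has no backtracking, also
when it runs through its base point. -/
def IsImmersedCycle {W : Type*} {Ω : SimpleGraph W} {w : W} (c : Ω.Walk w w) : Prop :=
  0 < c.length ∧ NoBacktrack (c.append c).support

section

variable {V W : Type*} {Ω : SimpleGraph W} {Θ : SimpleGraph V} (f : Ω →g Θ)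

/-- Combinatorial homotopy, rel endpoints, of edge paths in the graphical complex of `f`:
generated by removing (or inserting) backtrackings and boundary loops of `2`-cells. -/
inductive Homotopic : ∀ {u v : V}, Θ.Walk u v → Θ.Walk u v → Prop
  | refl {u v : V} (p : Θ.Walk u v) : Homotopic p p
  | symm {u v : V} {p q : Θ.Walk u v} : Homotopic p q → Homotopic q p
  | trans {u v : V} {p q r : Θ.Walk u v} : Homotopic p q → Homotopic q r → Homotopic p r
  | backtrack {u v w x : V} (p : Θ.Walk u v) (h : Θ.Adj v w) (q : Θ.Walk v x) :
      Homotopic (p.append (.cons h (.cons h.symm q))) (p.append q)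
  | cell {u x : V} {w : W} (c : Ω.Walk w w) (hc : IsImmersedCycle c)
      (p : Θ.Walk u (f w)) (q : Θ.Walk (f w) x) :
      Homotopic (p.append ((c.map f).append q)) (p.append q)

/-- The graphical complex of `f` is simply connected: it is connected and its edge-path
group (that is, its fundamental group) is trivial. -/
def SimplyConnected : Prop :=
  Θ.Connected ∧ ∀ (u : V) (p : Θ.Walk u u), Homotopic f p .nil

/-! ### Pieces and the condition `C(p)` -/

/-- `l` is an immersed nontrivial path in `Θ`, and `l₁`, `l₂` are two distinct lifts of it
to `Ω`. -/
structure IsPieceVia (l : List V) (l₁ l₂ : List W) : Prop where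
  nontrivial : 2 ≤ l.length
  isPath : l.IsChain Θ.Adj
  immersed : NoBacktrack l
  isPath₁ : l₁.IsChain Ω.Adj
  isPath₂ : l₂.IsChain Ω.Adj
  map₁ : l₁.map f = l
  map₂ : l₂.map f = l
  ne : l₁ ≠ l₂

/-- A piece: an immersed nontrivial path in `Θ` with two distinct lifts to `Ω`. -/
def IsPiece (l : List V) : Prop := ∃ l₁ l₂ : List W, IsPieceVia f l l₁ l₂

/-- `IsPieceConcat f k p`: the walk `p` is a concatenation of `k` pieces. -/
inductive IsPieceConcat : ∀ {u v : V}, ℕ → Θ.Walk u v → Prop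
  | nil (u : V) : IsPieceConcat 0 (.nil : Θ.Walk u u)
  | append {u v w : V} {k : ℕ} (p : Θ.Walk u v) (q : Θ.Walk v w) :
      IsPiece f p.support → IsPieceConcat k q → IsPieceConcat (k + 1) (p.append q)

/-- The condition `C(p)`: no immersed cycle `C → Ω → Θ` is a concatenation of fewer than `p`
pieces. -/
def SatisfiesC (p : ℕ) : Prop :=
  ∀ (w : W) (c : Ω.Walk w w), IsImmersedCycle c → ∀ k < p, ¬ IsPieceConcat f k (c.map f)

end

/-! ### Disc diagrams and the condition `T(q)` -/

/-- A combinatorial cell structure on the `2`-sphere, given by its finite set of darts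
(oriented edges), the reversal `rev` of darts, and the permutation `faceNext` which sends a dart
to the one following it on the boundary of the face on its left. Faces are the cycles of
`faceNext`; vertices (sets of darts with a common tail) are the cycles of
`d ↦ faceNext (rev d)`. The surface is connected, of Euler characteristic `2`. -/
structure SphereMap where
  Dart : Type
  [finite : Finite Dart]
  rev : Equiv.Perm Dart
  faceNext : Equiv.Perm Dart
  rev_rev : ∀ d, rev (rev d) = d
  rev_ne : ∀ d, rev d ≠ d
  connected : ∀ d e : Dart, ∃ g ∈ Subgroup.closure {rev, faceNext}, g d = e
  euler : 2 * (Nat.card (Quotient (Equiv.Perm.SameCycle.setoid (faceNext * rev)))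
    + Nat.card (Quotient (Equiv.Perm.SameCycle.setoid faceNext))) = Nat.card Dart + 4

namespace SphereMap

/-- Rotation of the darts about their tail. -/
def vertexNext (M : SphereMap) : Equiv.Perm M.Dart := M.faceNext * M.rev

/-- Two darts have the same tail. -/
def SameTail (M : SphereMap) (d e : M.Dart) : Prop := M.vertexNext.SameCycle d e

/-- The degree of the tail of `d`. -/
noncomputable def degree (M : SphereMap) (d : M.Dart) : ℕ := {e | M.SameTail d e}.ncard

end SphereMap

/-- A sphere with one face (the one containing the dart `outer`) removed. -/
structure Disc extends SphereMap where
  outer : Dart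

namespace Disc

/-- The darts on boundaries of the `2`-cells of the disc. -/
def IsInner (D : Disc) (d : D.Dart) : Prop := ¬ D.faceNext.SameCycle D.outer d

theorem IsInner.faceNext {D : Disc} {d : D.Dart} (h : D.IsInner d) : D.IsInner (D.faceNext d) :=
  fun h' => h (Equiv.Perm.sameCycle_apply_right.mp h')

/-- The tail of `d` is an interior vertex of the disc: it is not on the boundary of the removed
face. -/
def IsInteriorVertex (D : Disc) (d : D.Dart) : Prop := ∀ e, D.SameTail d e → D.IsInner e

/-- The vertices of the disjoint union `⊔ ∂R` of the boundary cycles of the `2`-cells `R`: a dart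
`d` stands for the occurrence of its tail in front of `d` on the boundary of its `2`-cell. -/
def Corner (D : Disc) : Type := {d : D.Dart // D.IsInner d}

/-- The following vertex on the same boundary cycle. -/
def cornerNext (D : Disc) (c : D.Corner) : D.Corner := ⟨D.faceNext c.1, c.2.faceNext⟩

/-- The oriented edges of `⊔ ∂R`: `(c, true)` runs from `c` to `cornerNext c`, and `(c, false)`
is its inverse. -/
def Step (D : Disc) : Type := D.Corner × Bool

def Step.source {D : Disc} (x : D.Step) : D.Corner := if x.2 then x.1 else D.cornerNext x.1

def Step.target {D : Disc} (x : D.Step) : D.Corner := if x.2 then D.cornerNext x.1 else x.1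

/-- The map `⊔ ∂R → D` on oriented edges. -/
def Step.dart {D : Disc} (x : D.Step) : D.Dart := if x.2 then x.1.1 else D.rev x.1.1

/-- An immersed path in the `1`-skeleton of the disc, as the list of its oriented edges. -/
def IsImmersedPath (D : Disc) (l : List D.Dart) : Prop :=
  l.IsChain fun d e => D.SameTail (D.rev d) e ∧ e ≠ D.rev d

/-- `m` is a path in `⊔ ∂R` which is mapped to the path `l` of the disc; that is, a
factorization of `l` through a `2`-cell. -/
def IsLift (D : Disc) (l : List D.Dart) (m : List D.Step) : Prop :=
  (m.IsChain fun x y => x.target = y.source) ∧ m.map Step.dart = l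

end Disc

/-- The successive vertices of a path given by its list of oriented edges. -/
def vertexList {α β : Type*} (source target : α → β) : List α → List β
  | [] => []
  | [a] => [source a, target a]
  | a :: b :: l => source a :: vertexList source target (b :: l)

section

variable {V W : Type*} {Ω : SimpleGraph W} {Θ : SimpleGraph V} (f : Ω →g Θ)

/-- A disc diagram over the graphical complex `X` of `f`, i.e. a combinatorial map from a disc to
`X`. It maps vertices to vertices and edges to edges, and a `2`-cell `R` to a `2`-cell of `X`, so
that `∂R → Θ` is the composition of an immersed cycle `∂R → Ω`, given by `lift`, with `f`. -/
structure DiscDiagram extends Disc where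
  /-- the image of the tail of a dart -/
  vert : Dart → V
  vert_eq : ∀ d e, toSphereMap.SameTail d e → vert d = vert e
  adj : ∀ d, Θ.Adj (vert d) (vert (rev d))
  lift : toDisc.Corner → W
  f_lift : ∀ c, f (lift c) = vert c.1
  lift_adj : ∀ c, Ω.Adj (lift c) (lift (toDisc.cornerNext c))
  lift_immersed : ∀ c, lift c ≠ lift (toDisc.cornerNext (toDisc.cornerNext c))

variable {f}

/-- A piece of a disc diagram is an immersed nontrivial path `P → D` which factors in two distinct
ways through `2`-cells `P → R → D`. The diagram is reduced if every such `P → D → X` is a piece of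
`X`, by the two lifts `P → R → Ω` which these factorizations induce. -/
def DiscDiagram.IsReduced (D : DiscDiagram f) : Prop :=
  ∀ l : List D.Dart, l ≠ [] → D.IsImmersedPath l →
    ∀ m₁ m₂ : List D.Step, D.IsLift l m₁ → D.IsLift l m₂ → m₁ ≠ m₂ →
      IsPieceVia f (vertexList D.vert (fun d => D.vert (D.rev d)) l)
        ((vertexList Disc.Step.source Disc.Step.target m₁).map D.lift)
        ((vertexList Disc.Step.source Disc.Step.target m₂).map D.lift)

variable (f)

/-- The condition `T(q)`: no reduced disc diagram has an interior vertex of degree greater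
than `2` and less than `q`. -/
def SatisfiesT (q : ℕ) : Prop :=
  ∀ D : DiscDiagram f, D.IsReduced → ∀ d : D.Dart, D.IsInteriorVertex d →
    ¬ (2 < D.degree d ∧ D.degree d < q)

/-! ### The thickening -/

/-- The graph obtained from `Θ` by making the image of each connected component of `Ω`
a clique. -/
def thickGraph : SimpleGraph V where
  Adj u v := u ≠ v ∧ (Θ.Adj u v ∨ ∃ x y : W, Ω.Reachable x y ∧ f x = u ∧ f y = v)
  symm := ⟨fun _ _ h => ⟨h.1.symm, h.2.imp (fun h => h.symm)
    fun ⟨x, y, hxy, hx, hy⟩ => ⟨y, x, hxy.symm, hy, hx⟩⟩⟩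
  loopless := ⟨fun _ h => h.1 rfl⟩

/-- The thickening `Th(X)` of the graphical complex of `f`. -/
def thickening : AbstractSimplicialComplex V := flagCompletion (thickGraph f)

end

end Graphical

-- The geometry of `Th(X)` is controlled by its links. Regard it as a system of darts and triangles,
-- where a triangle comes from three vertices of one component of `Ω`. Two darts at a vertex `v` are
-- linked if they span a triangle, that is, if they are distinct and carried by a common lift of `v`
-- to `Ω`. In an induced cycle of length 4 or 5 in the link, successive lifts differ and share a
-- dart, which must be an edge of `Θ`. Since any two edges at a vertex of `Ω` are successive in some
-- immersed cycle, such a configuration produces 4 or 5 polygons around an interior vertex: a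
-- reduced diagram forbidden by `T(6)` (`SatisfiesT.not_cycle`). Stars of 3 and 4 polygons also show
-- that `f` is locally injective, that two lifts share at most one dart, and that three pairwise
-- linked darts have a common lift.
--
-- For a system with such links the universal cover is built sphere by sphere about a base point.
-- Outgoing darts are identified where triangles force it; the link conditions make this an
-- equivalence relation and propagate two invariants: the darts from a vertex to the preceding
-- sphere are pairwise linked, and the ends of an edge inside a sphere have a common parent. Walks
-- of `Θ` lift uniquely, and images of closed walks of `Ω` lift to closed walks, so simple
-- connectivity of `X` makes the covering map injective (`SimplyConnected.coversInjectively`). The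
-- spheres of the cover then give the metric spheres of the graph.
--
-- Now consider an isometric cycle. If its length is even and at least 4, the two neighbours of the
-- vertex opposite to the base point are parents of it, hence adjacent, although their distance is
-- 2. If it is odd and at least 5, the edge opposite to the base point has a parent adjacent to four
-- consecutive vertices; this forces length 5 and puts the pentagon into the link of that parent,
-- where it is excluded.

universe u v

/-- A system of darts over a vertex set together with triangles: `L a b c` says that the darts `a`
and `b` have the same source and span a triangle whose third side is the dart `c` from the target
of `a` to the target of `b`. The links have neither induced `4`-cycles nor induced `5`-cycles. -/
structure TriSystem (V : Type u) (E : Type v) where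
  src : E → V
  tgt : E → V
  rev : E → E
  L : E → E → E → Prop
  rev_rev : ∀ a, rev (rev a) = a
  src_rev : ∀ a, src (rev a) = tgt a
  src_left : ∀ {a b c}, L a b c → src b = src a
  src_third : ∀ {a b c}, L a b c → src c = tgt a
  tgt_third : ∀ {a b c}, L a b c → tgt c = tgt b
  swap : ∀ {a b c}, L a b c → L b a (rev c)
  rot : ∀ {a b c}, L a b c → L (rev a) c b
  unique : ∀ {a b c c'}, L a b c → L a b c' → c = c'
  irrefl : ∀ {a c}, ¬ L a a c
  tetra : ∀ {a b b' c c' d}, L a b c → L a b' c' → L b b' d → L c c' d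
  four : ∀ {a b c d}, (∃ x, L a b x) → (∃ x, L b c x) → (∃ x, L c d x) → (∃ x, L d a x) →
    a ≠ c → b ≠ d → (∃ x, L a c x) ∨ ∃ x, L b d x
  five : ∀ {a b c d e}, (∃ x, L a b x) → (∃ x, L b c x) → (∃ x, L c d x) → (∃ x, L d e x) →
    (∃ x, L e a x) → a ≠ c → a ≠ d → b ≠ d → b ≠ e → c ≠ e →
    (∃ x, L a c x) ∨ (∃ x, L a d x) ∨ (∃ x, L b d x) ∨ (∃ x, L b e x) ∨ ∃ x, L c e x

/-! ### Spheres of the universal cover, by induction on the radius. -/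

namespace TriSystem

variable {V : Type u} {E : Type v} (Y : TriSystem V E)

variable {Y} in
theorem rot_swap {a b c : E} (h : Y.L a b c) : Y.L (Y.rev b) (Y.rev c) a := Y.rot (Y.swap h)

variable {Y} in
theorem rot' {a b c : E} (h : Y.L (Y.rev a) c b) : Y.L a b c := by
  simpa [Y.rev_rev] using Y.rot h

/-- A sphere of the universal cover: `P w a` says that the dart `a` at `w` leads to the preceding
sphere, and `Q w c w'` that the dart `c` leads from `w` to `w'` within the sphere. -/
structure Sphere where
  S : Type v
  φ : S → V
  P : S → E → Prop
  Q : S → E → S → Prop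
  Q_src : ∀ {w c w'}, Q w c w' → Y.src c = φ w
  Q_symm : ∀ {w c w'}, Q w c w' → Q w' (Y.rev c) w
  Q_fun : ∀ {w c w' w''}, Q w c w' → Q w c w'' → w' = w''
  Q_label : ∀ {w c c' w'}, Q w c w' → Q w c' w' → c = c'
  Q_irrefl : ∀ {w c}, ¬ Q w c w
  P_not_Q : ∀ {w c w'}, P w c → ¬ Q w c w'
  P_clique : ∀ {w p p'}, P w p → P w p' → p ≠ p' → ∃ c, Y.L p p' c
  P_closed : ∀ {w p c e}, P w p → Y.L p c e → P w c ∨ ∃ w', Q w c w'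
  P_third : ∀ {w p c e w'}, P w p → Y.L p c e → Q w c w' → P w' (Y.rev e)
  Q_parent : ∀ {w c w'}, Q w c w' → ∃ p e, P w p ∧ Y.L p c e
  Q_third : ∀ {w c c' w' w'' e}, Q w c w' → Q w c' w'' → Y.L c c' e → Q w' e w''
  Q_triangle : ∀ {w c c' w' w'' e}, Q w c w' → Q w c' w'' → Q w' e w'' → Y.L c c' e

namespace Sphere

variable {Y} (B : Y.Sphere)

/-- The sphere of radius `0`. -/
def root (Y : TriSystem V E) (o : V) : Y.Sphere where
  S := PUnit
  φ _ := o
  P _ _ := False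
  Q _ _ _ := False
  Q_src h := h.elim
  Q_symm h := h.elim
  Q_fun h := h.elim
  Q_label h := h.elim
  Q_irrefl h := h
  P_not_Q h := h.elim
  P_clique h := h.elim
  P_closed h := h.elim
  P_third h := h.elim
  Q_parent h := h.elim
  Q_third h := h.elim
  Q_triangle h := h.elim

theorem Q_tgt {w c w'} (h : B.Q w c w') : Y.tgt c = B.φ w' := by
  rw [← B.Q_src (B.Q_symm h), Y.src_rev]

/-- The darts at `w` which lead to the following sphere. -/
def New (w : B.S) (a : E) : Prop := Y.src a = B.φ w ∧ ¬ B.P w a ∧ ∀ w', ¬ B.Q w a w'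

variable {B}

theorem New.not_L {w : B.S} {a p e : E} (h : B.New w a) (hp : B.P w p) : ¬ Y.L p a e := fun hL =>
  (B.P_closed hp hL).elim h.2.1 fun ⟨w', hw'⟩ => h.2.2 w' hw'

theorem New.third {w w' : B.S} {a a' c : E} (h : B.New w a) (hc : B.Q w c w') (hL : Y.L c a a') :
    B.New w' a' := by
  refine ⟨(Y.src_third hL).trans (B.Q_tgt hc), fun hP => ?_, fun w'' hQ => ?_⟩
  · have := B.P_third hP (Y.swap (Y.rot hL)) (B.Q_symm hc)
    exact h.2.1 (by simpa [Y.rev_rev] using this)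
  · exact h.2.2 _ (B.Q_third (B.Q_symm hc) hQ (Y.rot hL))

/-- Two darts to the following sphere have the same end. -/
def Rel (B : Y.Sphere) (x y : {x : B.S × E // B.New x.1 x.2}) : Prop :=
  x = y ∨ ∃ c, B.Q x.1.1 c y.1.1 ∧ Y.L c x.1.2 y.1.2

/-- With parents `p` of `c` and `q` of `d`, the darts `a, c, p, q, d` form a closed path of length
at most 5 in the link. A new dart is never linked to a parent, so the chord supplied by `four` or
`five` leads to `c` and `d` being linked. -/
theorem link_of_new {w w₁ w₂ : B.S} {a c d x y : E} (ha : B.New w a) (hc : B.Q w c w₁)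
    (hd : B.Q w d w₂) (hca : Y.L c a x) (hda : Y.L d a y) (hcd : c ≠ d) : ∃ e, Y.L c d e := by
  obtain ⟨p, e, hp, hpc⟩ := B.Q_parent hc
  obtain ⟨q, e', hq, hqd⟩ := B.Q_parent hd
  have hap : a ≠ p := fun h => ha.2.1 (h ▸ hp)
  have haq : a ≠ q := fun h => ha.2.1 (h ▸ hq)
  have nap : ¬ ∃ x, Y.L a p x := fun ⟨x, hx⟩ => ha.not_L hp (Y.swap hx)
  have naq : ¬ ∃ x, Y.L a q x := fun ⟨x, hx⟩ => ha.not_L hq (Y.swap hx)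
  have hcq : c ≠ q := fun h => B.P_not_Q hq (h ▸ hc)
  have hpd : p ≠ d := fun h => B.P_not_Q hp (h ▸ hd)
  by_cases h1 : ∃ x, Y.L p d x
  · exact (Y.four ⟨_, Y.swap hca⟩ ⟨_, Y.swap hpc⟩ h1 ⟨_, hda⟩ hap hcd).resolve_left nap
  by_cases h2 : ∃ x, Y.L c q x
  · exact (Y.four ⟨_, Y.swap hca⟩ h2 ⟨_, hqd⟩ ⟨_, hda⟩ haq hcd).resolve_left naq
  have hpq : p ≠ q := fun h => h1 ⟨_, h ▸ hqd⟩
  rcases Y.five ⟨_, Y.swap hca⟩ ⟨_, Y.swap hpc⟩ (B.P_clique hp hq hpq) ⟨_, hqd⟩ ⟨_, hda⟩ hap haq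
    hcq hcd hpd with h | h | h | h | h
  · exact (nap h).elim
  · exact (naq h).elim
  · exact (h2 h).elim
  · exact h
  · exact (h1 h).elim

/-- Only transitivity needs the link conditions: two identifications through the middle vertex `w'`
give sibling darts both linked to one new dart, hence linked to each other, and `tetra` closes the
triangle. -/
theorem rel_equivalence (B : Y.Sphere) : Equivalence B.Rel where
  refl x := .inl rfl
  symm := by
    rintro x y (rfl | ⟨c, hc, hL⟩)
    · exact .inl rfl
    · exact .inr ⟨_, B.Q_symm hc, Y.rot hL⟩
  trans := by
    rintro ⟨⟨w, a⟩, hx⟩ ⟨⟨w', a'⟩, hy⟩ ⟨⟨w'', a''⟩, hz⟩ (h | ⟨c, hc, hL⟩) h2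
    · rwa [h]
    obtain (h2 | ⟨d, hd, hL'⟩) := h2
    · rw [← h2]; exact .inr ⟨c, hc, hL⟩
    dsimp only at *
    by_cases hcd : Y.rev c = d
    · subst hcd
      left
      obtain rfl := B.Q_fun (B.Q_symm hc) hd
      obtain rfl := Y.unique (Y.rot hL) hL'
      rfl
    · obtain ⟨e, he⟩ := link_of_new hy (B.Q_symm hc) hd (Y.rot hL) hL' hcd
      exact .inr ⟨e, B.Q_third (B.Q_symm hc) hd he, Y.tetra he (Y.rot hL) hL'⟩

/-- The vertices of the following sphere. -/
def NextS (B : Y.Sphere) : Type v := Quotient ⟨B.Rel, B.rel_equivalence⟩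

/-- `Up w a z` says that the dart `a` leads from `w` to the vertex `z` of the following sphere. -/
def Up (B : Y.Sphere) (w : B.S) (a : E) (z : B.NextS) : Prop :=
  ∃ h : B.New w a, (Quotient.mk _ ⟨(w, a), h⟩ : B.NextS) = z

theorem exists_up (z : B.NextS) : ∃ w a, B.Up w a z := by
  obtain ⟨⟨⟨w, a⟩, h⟩, rfl⟩ := Quotient.exists_rep z
  exact ⟨w, a, h, rfl⟩

theorem New.exists_up {w : B.S} {a : E} (h : B.New w a) : ∃ z, B.Up w a z := ⟨_, h, rfl⟩

theorem Up.unique {w : B.S} {a : E} {z z' : B.NextS} (h : B.Up w a z) (h' : B.Up w a z') :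
    z = z' := by
  obtain ⟨_, rfl⟩ := h
  obtain ⟨_, rfl⟩ := h'
  rfl

theorem Up.cases {w w' : B.S} {a a' : E} {z : B.NextS} (h : B.Up w a z) (h' : B.Up w' a' z) :
    (w = w' ∧ a = a') ∨ ∃ c, B.Q w c w' ∧ Y.L c a a' := by
  obtain ⟨_, rfl⟩ := h
  obtain ⟨_, h2⟩ := h'
  rcases Quotient.exact h2.symm with h | h
  · rw [Subtype.mk.injEq, Prod.mk.injEq] at h
    exact .inl h
  · exact .inr h

theorem Up.trans {w w' : B.S} {a a' c : E} {z : B.NextS} (h : B.Up w a z) (hc : B.Q w c w')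
    (hL : Y.L c a a') : B.Up w' a' z := by
  obtain ⟨h, rfl⟩ := h
  exact ⟨h.third hc hL, (Quotient.sound (Or.inr ⟨c, hc, hL⟩)).symm⟩

theorem Up.label {w : B.S} {a a' : E} {z : B.NextS} (h : B.Up w a z) (h' : B.Up w a' z) :
    a = a' := by
  rcases h.cases h' with h | ⟨c, hc, -⟩
  · exact h.2
  · exact (B.Q_irrefl hc).elim

/-- The parents of a vertex span triangles with it. -/
theorem Up.parents {w w' : B.S} {a a' : E} {z : B.NextS} (h : B.Up w a z) (h' : B.Up w' a' z) :
    (w = w' ∧ a = a') ∨ ∃ c, B.Q w c w' ∧ Y.L c a a' ∧ Y.L (Y.rev a) (Y.rev a') c :=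
  (h.cases h').imp_right fun ⟨c, hc, hL⟩ => ⟨c, hc, hL, rot_swap hL⟩

/-- Adjacency in the next sphere is witnessed by one common parent; this makes the witness
irrelevant. Two common parents are joined by a sibling dart, and `tetra` carries the triangle across
it. -/
theorem Up.triangle {w w' : B.S} {a a' b b' d : E} {z z' : B.NextS} (ha : B.Up w a z)
    (ha' : B.Up w' a' z) (hb : B.Up w b z') (hb' : B.Up w' b' z') (h : Y.L a b d) :
    Y.L a' b' d := by
  rcases ha.cases ha' with ⟨rfl, rfl⟩ | ⟨c, hc, hL⟩
  · rwa [← hb.label hb']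
  rcases hb.cases hb' with ⟨rfl, rfl⟩ | ⟨c', hc', hL'⟩
  · exact (B.Q_irrefl hc).elim
  · obtain rfl := B.Q_label hc hc'
    exact Y.tetra hL hL' h

/-- Adjacency in the following sphere. -/
def NextQ (B : Y.Sphere) (z : B.NextS) (d : E) (z' : B.NextS) : Prop :=
  ∃ w a b, B.Up w a z ∧ B.Up w b z' ∧ Y.L a b d

/-- A vertex of a sphere whose dart to a parent of a neighbour spans a triangle is adjacent to
this parent, too. -/
theorem NextQ.up {w : B.S} {a b d : E} {z z' : B.NextS} (h : B.NextQ z d z') (ha : B.Up w a z)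
    (hL : Y.L (Y.rev a) d b) : B.Up w b z' := by
  obtain ⟨w₀, a₀, b₀, ha₀, hb₀, h₀⟩ := h
  rcases ha₀.parents ha with ⟨rfl, rfl⟩ | ⟨c, hc, -, hcL⟩
  · rwa [← Y.unique (Y.rot h₀) hL]
  · exact hb₀.trans hc (Y.tetra hcL (Y.rot h₀) hL)

theorem NextQ.symm {d : E} {z z' : B.NextS} (h : B.NextQ z d z') : B.NextQ z' (Y.rev d) z := by
  obtain ⟨w, a, b, ha, hb, h⟩ := h
  exact ⟨w, b, a, hb, ha, Y.swap h⟩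

theorem NextQ.not_up {w : B.S} {a d : E} {z z' : B.NextS} (h : B.NextQ z d z')
    (ha : B.Up w a z) : Y.rev a ≠ d := by
  rintro rfl
  obtain ⟨w₀, a₀, b₀, ha₀, hb₀, h₀⟩ := h
  rcases ha₀.parents ha with ⟨rfl, rfl⟩ | ⟨c, hc, -, hcL⟩
  · exact Y.irrefl (Y.rot h₀)
  · obtain rfl := Y.unique (Y.rot h₀) hcL
    exact hb₀.1.2.2 _ hc

/-- If the parents witnessing the two adjacencies differ, the darts `d`, `rev a`, `rev a'`, `d'`
form a 4-cycle in the link of `z`; either chord turns one parent into a parent of all three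
vertices. -/
theorem NextQ.common {d d' e : E} {z z' z'' : B.NextS} (h : B.NextQ z d z') (h' : B.NextQ z d' z'')
    (hL : Y.L d d' e) : ∃ w a b b', B.Up w a z ∧ B.Up w b z' ∧ B.Up w b' z'' ∧
      Y.L (Y.rev a) d b ∧ Y.L (Y.rev a) d' b' := by
  obtain ⟨w, a, b, ha, hb, h1⟩ := id h
  obtain ⟨w', a', b', ha', hb', h2⟩ := id h'
  have key : (∃ x, Y.L d (Y.rev a') x) ∨ ∃ x, Y.L (Y.rev a) d' x := by
    rcases ha.parents ha' with ⟨rfl, rfl⟩ | ⟨c, -, -, hcL⟩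
    · exact .inl ⟨_, Y.swap (Y.rot h1)⟩
    · exact Y.four ⟨_, Y.swap (Y.rot h1)⟩ ⟨_, hcL⟩ ⟨_, Y.rot h2⟩ ⟨_, Y.swap hL⟩
        (h.not_up ha').symm (h'.not_up ha)
  rcases key with ⟨x, hx⟩ | ⟨x, hx⟩
  · exact ⟨w', a', _, b', ha', h.up ha' (Y.swap hx), hb', Y.swap hx, Y.rot h2⟩
  · exact ⟨w, a, b, _, ha, hb, h'.up ha hx, Y.rot h1, hx⟩

/-- It suffices to find a common parent of the three vertices. Otherwise the parents `w₁, w₂, w₃` of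
the three pairs form a triangle below, and in the link of `w₁` the darts `x, a₁, b₁, y` form a
4-cycle; a chord shows that `w₂` or `w₃` is a common parent. -/
theorem NextQ.triangle {d d' e : E} {z z' z'' : B.NextS} (h : B.NextQ z d z')
    (h' : B.NextQ z d' z'') (h'' : B.NextQ z' e z'') : Y.L d d' e := by
  obtain ⟨w₁, a₁, b₁, ha₁, hb₁, h₁⟩ := h
  obtain ⟨w₂, a₂, c₂, ha₂, hc₂, h₂⟩ := h'
  obtain ⟨w₃, b₃, c₃, hb₃, hc₃, h₃⟩ := h''
  have key : ∀ {w a b c}, B.Up w a z → B.Up w b z' → B.Up w c z'' → Y.L d d' e :=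
    fun ha hb hc => Y.tetra (ha₁.triangle ha hb₁ hb h₁) (ha₂.triangle ha hc₂ hc h₂)
      (hb₃.triangle hb hc₃ hc h₃)
  rcases ha₁.cases ha₂ with ⟨rfl, rfl⟩ | ⟨x, hx, hxL⟩
  · exact key ha₁ hb₁ hc₂
  rcases hb₁.cases hb₃ with ⟨rfl, rfl⟩ | ⟨y, hy, hyL⟩
  · exact key ha₁ hb₁ hc₃
  rcases hc₂.cases hc₃ with ⟨rfl, rfl⟩ | ⟨u, hu, huL⟩
  · exact key ha₂ hb₃ hc₃
  have hxy := B.Q_triangle hx hy hu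
  rcases Y.four ⟨_, hxL⟩ ⟨_, h₁⟩ ⟨_, Y.swap hyL⟩ ⟨_, Y.swap hxy⟩
    (fun h => hb₁.1.2.2 _ (h ▸ hx)) (fun h => ha₁.1.2.2 _ (h ▸ hy)) with ⟨s, hs⟩ | ⟨s, hs⟩
  · exact key ha₂ (hb₁.trans hx hs) hc₂
  · exact key (ha₁.trans hy (Y.swap hs)) hb₃ hc₃

/-- The following sphere. -/
def next (B : Y.Sphere) : Y.Sphere where
  S := B.NextS
  φ := Quotient.lift (fun x => Y.tgt x.1.2) fun x y h => by
    rcases h with rfl | ⟨c, -, h⟩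
    · rfl
    · exact (Y.tgt_third h).symm
  P z e := ∃ w a, B.Up w a z ∧ Y.rev a = e
  Q := B.NextQ
  Q_src := by
    rintro z d z' ⟨w, a, b, ⟨h, rfl⟩, -, hL⟩
    exact Y.src_third hL
  Q_symm := NextQ.symm
  Q_fun := by
    rintro z d z' z'' ⟨w, a, b, ha, hb, h⟩ h'
    exact hb.unique (h'.up ha (Y.rot h))
  Q_label := by
    rintro z d d' z' ⟨w, a, b, ha, hb, h⟩ ⟨w', a', b', ha', hb', h'⟩
    exact Y.unique (ha.triangle ha' hb hb' h) h'
  Q_irrefl := by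
    rintro z d ⟨w, a, b, ha, hb, h⟩
    obtain rfl := ha.label hb
    exact Y.irrefl h
  P_not_Q := by
    rintro z _ z' ⟨w, a, ha, rfl⟩ h
    exact h.not_up ha rfl
  P_clique := by
    rintro z _ _ ⟨w, a, ha, rfl⟩ ⟨w', a', ha', rfl⟩ hne
    rcases ha.parents ha' with ⟨rfl, rfl⟩ | ⟨c, -, -, h⟩
    · exact (hne rfl).elim
    · exact ⟨c, h⟩
  P_closed := by
    rintro z _ c e ⟨w, a, ha, rfl⟩ hL
    have hL' := Y.swap (rot' hL)
    by_cases hP : B.P w e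
    -- The dart `e` is the side opposite to `z`. It cannot go down from `w`, since `a` is new. If it
    -- stays in the sphere of `w`, then `c` leads to another parent; if it goes up, `c` leads to a
    -- sibling.
    · exact (ha.1.not_L hP hL').elim
    by_cases hQ : ∃ w', B.Q w e w'
    · obtain ⟨w', hw'⟩ := hQ
      exact .inl ⟨w', _, ha.trans hw' hL', Y.rev_rev c⟩
    · obtain ⟨z', hz'⟩ := New.exists_up (B := B) (w := w) (a := e)
        ⟨(Y.src_left (rot' hL)).trans ha.1.1, hP, not_exists.mp hQ⟩
      exact .inr ⟨z', w, a, e, ha, hz', rot' hL⟩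
  P_third := by
    rintro z _ c e z' ⟨w, a, ha, rfl⟩ hL hQ
    exact ⟨w, e, hQ.up ha hL, rfl⟩
  Q_parent := by
    rintro z d z' ⟨w, a, b, ha, hb, h⟩
    exact ⟨_, _, ⟨w, a, ha, rfl⟩, Y.rot h⟩
  Q_third := by
    intro z d d' z' z'' e h h' hL
    obtain ⟨w, a, b, b', ha, hb, hb', h₁, h₂⟩ := h.common h' hL
    exact ⟨w, b, b', hb, hb', Y.tetra h₁ h₂ hL⟩
  Q_triangle := NextQ.triangle

theorem Up.φ_eq {w : B.S} {a : E} {z : B.NextS} (h : B.Up w a z) : B.next.φ z = Y.tgt a := by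
  obtain ⟨_, rfl⟩ := h
  rfl

end Sphere

end TriSystem

/-! ### The universal cover: unique lifting of darts and triangles. -/

namespace TriSystem

variable {V : Type u} {E : Type v} (Y : TriSystem V E)

open Sphere

/-- The spheres of the universal cover about a lift of `o`. -/
def sphere (o : V) : ℕ → Y.Sphere
  | 0 => root Y o
  | n + 1 => (sphere o n).next

/-- The vertices of the universal cover. -/
abbrev Cover (o : V) : Type v := Σ n, (Y.sphere o n).S

variable {o : V}

variable {Y} in
/-- The covering map on vertices. -/
def Cover.proj (x : Y.Cover o) : V := (Y.sphere o x.1).φ x.2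

/-- `CoverEdge x a y` says that the dart `a` lifts to a dart from `x` to `y`. -/
inductive CoverEdge : Y.Cover o → E → Y.Cover o → Prop
  | sib {n : ℕ} {w w' : (Y.sphere o n).S} {c : E} (h : (Y.sphere o n).Q w c w') :
      CoverEdge ⟨n, w⟩ c ⟨n, w'⟩
  | up {n : ℕ} {w : (Y.sphere o n).S} {z : (Y.sphere o (n + 1)).S} {a : E}
      (h : (Y.sphere o n).Up w a z) : CoverEdge ⟨n, w⟩ a ⟨n + 1, z⟩
  | down {n : ℕ} {w : (Y.sphere o n).S} {z : (Y.sphere o (n + 1)).S} {a : E}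
      (h : (Y.sphere o n).Up w a z) : CoverEdge ⟨n + 1, z⟩ (Y.rev a) ⟨n, w⟩

variable {Y}

namespace CoverEdge

theorem symm {x y : Y.Cover o} {a : E} (h : Y.CoverEdge x a y) : Y.CoverEdge y (Y.rev a) x := by
  cases h with
  | sib h => exact .sib ((Y.sphere o _).Q_symm h)
  | up h => exact .down h
  | down h => rw [Y.rev_rev]; exact .up h

theorem src_eq {x y : Y.Cover o} {a : E} (h : Y.CoverEdge x a y) : Y.src a = x.proj := by
  cases h with
  | sib h => exact (Y.sphere o _).Q_src h
  | up h => exact h.1.1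
  | down h => exact (Y.src_rev _).trans h.φ_eq.symm

theorem tgt_eq {x y : Y.Cover o} {a : E} (h : Y.CoverEdge x a y) : Y.tgt a = y.proj := by
  rw [← h.symm.src_eq, Y.src_rev]

theorem level_le {x y : Y.Cover o} {a : E} (h : Y.CoverEdge x a y) : y.1 ≤ x.1 + 1 := by
  cases h <;> (simp; try omega)

theorem exists_of_src_eq (x : Y.Cover o) {a : E} (h : Y.src a = x.proj) :
    ∃ y, Y.CoverEdge x a y := by
  obtain ⟨n, w⟩ := x
  by_cases hQ : ∃ w', (Y.sphere o n).Q w a w'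
  · obtain ⟨w', hw'⟩ := hQ
    exact ⟨_, .sib hw'⟩
  by_cases hP : (Y.sphere o n).P w a
  · cases n with
    | zero => exact hP.elim
    | succ n =>
      obtain ⟨w', b, hb, rfl⟩ := hP
      exact ⟨_, .down hb⟩
  · obtain ⟨z, hz⟩ := New.exists_up ⟨h, hP, not_exists.mp hQ⟩
    exact ⟨_, .up hz⟩

theorem P_of_up {n : ℕ} {w : (Y.sphere o n).S} {z : (Y.sphere o (n + 1)).S} {a : E}
    (h : (Y.sphere o n).Up w a z) : (Y.sphere o (n + 1)).P z (Y.rev a) := ⟨w, a, h, rfl⟩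

/-- The kinds sibling, up and down exclude one another for a given dart at a given vertex. For two
downward lifts, distinct parents would yield a dart linked to itself. -/
theorem unique {x y y' : Y.Cover o} {a : E} (h : Y.CoverEdge x a y) (h' : Y.CoverEdge x a y') :
    y = y' := by
  generalize ha : a = b at h'
  cases h with
  | sib h =>
    cases h' with
    | sib h' => rw [(Y.sphere o _).Q_fun h (ha ▸ h')]
    | up h' => exact (h'.1.2.2 _ (ha ▸ h)).elim
    | down h' => exact ((Y.sphere o _).P_not_Q (P_of_up h') (ha ▸ h)).elim
  | up h =>
    cases h' with
    | sib h' => exact (h.1.2.2 _ (ha ▸ h')).elim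
    | up h' => subst ha; rw [h.unique h']
    | down h' => exact (h.1.2.1 (ha ▸ P_of_up h')).elim
  | down h =>
    cases h' with
    | sib h' => exact ((Y.sphere o _).P_not_Q (P_of_up h) (ha ▸ h')).elim
    | up h' => exact (h'.1.2.1 (ha ▸ P_of_up h)).elim
    | down h' =>
      rcases h.parents h' with ⟨rfl, -⟩ | ⟨c, -, -, hL⟩
      · rfl
      · exact (Y.irrefl (ha ▸ hL)).elim

/-- Triangles lift to the universal cover. -/
theorem third {x y z : Y.Cover o} {a b c : E} (h : Y.CoverEdge x a y) (h' : Y.CoverEdge x b z)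
    (hL : Y.L a b c) : Y.CoverEdge y c z := by
  have sib_down : ∀ {n : ℕ} {w : (Y.sphere o n).S} {x y : (Y.sphere o (n + 1)).S} {a b c : E},
      (Y.sphere o (n + 1)).Q x a y → (Y.sphere o n).Up w b x → Y.L (Y.rev b) a c →
      Y.CoverEdge ⟨n, w⟩ c ⟨n + 1, y⟩ := fun h h' hL => .up (NextQ.up h h' hL)
  generalize hb : b = b' at h'
  cases h with
  | sib h =>
    cases h' with
    | sib h' => exact .sib ((Y.sphere o _).Q_third h (hb ▸ h') hL)
    | up h' => subst hb; exact .up (h'.trans h hL)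
    | down h' => subst hb; simpa [Y.rev_rev] using (sib_down h h' (Y.swap hL)).symm
  | up h =>
    cases h' with
    | sib h' =>
      subst hb
      have := CoverEdge.down (h.trans h' (Y.swap hL))
      rwa [Y.rev_rev] at this
    | up h' => subst hb; exact .sib ⟨_, _, _, h, h', hL⟩
    -- One side up and the other down is impossible: levels would differ by two along the third
    -- side.
    | down h' => subst hb; exact (h.1.not_L (P_of_up h') (Y.swap hL)).elim
  | down h =>
    cases h' with
    | sib h' => subst hb; exact sib_down h' h hL
    | up h' => subst hb; exact (h'.1.not_L (P_of_up h) hL).elim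
    | down h' =>
      rcases h.parents h' with ⟨rfl, rfl⟩ | ⟨c', hc', -, hL'⟩
      · exact (Y.irrefl (hb ▸ hL)).elim
      · subst hb; obtain rfl := Y.unique hL hL'; exact .sib hc'

end CoverEdge

end TriSystem

/-! ### Distances in cycle graphs. -/

namespace SimpleGraph

theorem cycleGraph_adj_cases {n : ℕ} {u v : Fin n} (h : (cycleGraph n).Adj u v) :
    (v : ℕ) = u + 1 ∨ (u : ℕ) = v + 1 ∨ ((u : ℕ) = 0 ∧ (v : ℕ) + 1 = n) ∨
      ((v : ℕ) = 0 ∧ (u : ℕ) + 1 = n) := by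
  rw [cycleGraph_adj'] at h
  have hu := u.2
  have hv := v.2
  rcases lt_or_ge u v with h' | h'
  · rw [Fin.coe_sub_iff_lt.mpr h', Fin.coe_sub_iff_le.mpr h'.le] at h
    have : (u : ℕ) < v := h'
    omega
  · rw [Fin.coe_sub_iff_le.mpr h'] at h
    rcases h'.eq_or_lt with h'' | h''
    · subst h''
      have := Fin.coe_sub_iff_le.mpr (le_refl v)
      omega
    · rw [Fin.coe_sub_iff_lt.mpr h''] at h
      have : (v : ℕ) < u := h''
      omega

theorem cycleGraph_adj_of_succ {n : ℕ} {u v : Fin n} (h : (v : ℕ) = u + 1) :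
    (cycleGraph n).Adj u v := by
  rw [cycleGraph_adj']
  right
  have : u ≤ v := by rw [Fin.le_def]; omega
  rw [Fin.coe_sub_iff_le.mpr this]
  omega

theorem cycleGraph_adj_last {n : ℕ} (hn : 2 ≤ n) {u v : Fin n} (hu : (u : ℕ) = 0)
    (hv : (v : ℕ) + 1 = n) : (cycleGraph n).Adj u v := by
  rw [cycleGraph_adj']
  left
  have : u < v := by rw [Fin.lt_def]; omega
  rw [Fin.coe_sub_iff_lt.mpr this]
  omega

theorem cycleGraph_dist_le {n : ℕ} {u v : Fin n} (h : u ≤ v) :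
    (cycleGraph n).dist u v ≤ v - u := by
  obtain ⟨k, hk⟩ := Nat.exists_eq_add_of_le (Fin.le_def.mp h)
  induction k generalizing v with
  | zero =>
    obtain rfl : v = u := Fin.ext hk
    simp
  | succ k ih =>
    have hv := v.2
    let v' : Fin n := ⟨u + k, by omega⟩
    have h1 := ih (v := v') (by rw [Fin.le_def]; simp [v']) rfl
    have h2 : (cycleGraph n).Adj v' v := cycleGraph_adj_of_succ (by simp [v']; omega)
    have h3 := (h2.diff_dist_adj (u := u))
    have : ((v' : Fin n) : ℕ) = u + k := rfl
    omega

/-- Distances in cycle graphs. -/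
theorem cycleGraph_dist {n : ℕ} {u v : Fin n} (h : u ≤ v) :
    (cycleGraph n).dist u v = min (v - u : ℕ) (n - (v - u)) := by
  have hv := v.2
  have huv : (u : ℕ) ≤ v := h
  have hc : (cycleGraph n).Connected := by
    obtain ⟨m, rfl⟩ : ∃ m, n = m + 1 := ⟨n - 1, by omega⟩
    exact cycleGraph_connected
  apply le_antisymm
  · refine le_min (cycleGraph_dist_le h) ?_
    rcases Nat.lt_or_ge n 2 with hn | hn
    · have := cycleGraph_dist_le h
      omega
    · let o : Fin n := ⟨0, by omega⟩
      let l : Fin n := ⟨n - 1, by omega⟩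
      have h1 := cycleGraph_dist_le (n := n) (u := o) (v := u) (Fin.le_def.mpr (Nat.zero_le _))
      have h2 := cycleGraph_dist_le (n := n) (u := v) (v := l) (Fin.le_def.mpr (by simp [l]; omega))
      have h3 := dist_eq_one_iff_adj.mpr
        (cycleGraph_adj_last hn (u := o) (v := l) rfl (by simp [l]; omega))
      have h4 := hc.dist_triangle (u := u) (v := o) (w := v)
      have h5 := hc.dist_triangle (u := o) (v := l) (w := v)
      rw [dist_comm (u := u) (v := o)] at h4
      rw [dist_comm (u := l) (v := v)] at h5
      have : (o : ℕ) = 0 := rfl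
      have : (l : ℕ) = n - 1 := rfl
      omega
  · obtain ⟨p, hp⟩ := hc.exists_walk_length_eq_dist u v
    rw [← hp]
    -- The cyclic distance of the labels changes by at most one along an edge, so it bounds the
    -- length of every walk from below.
    have key : ∀ {x y : Fin n} (q : (cycleGraph n).Walk x y),
        min (max (x : ℕ) y - min (x : ℕ) y) (n - (max (x : ℕ) y - min (x : ℕ) y)) ≤ q.length := by
      intro x y q
      induction q with
      | nil => simp
      | @cons a b c hab q ih =>
        have h1 := cycleGraph_adj_cases hab
        have ha := a.2
        have hb := b.2
        have hc := c.2
        rw [Walk.length_cons]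
        omega
    have := key p
    omega

end SimpleGraph

/-! ### From an injective universal covering to bridged graphs. -/

namespace TriSystem

variable {V : Type u} {E : Type v} {Y : TriSystem V E} {o : V} {G : SimpleGraph V}

open Sphere

/-- A graph is the `1`-skeleton of a system of darts and triangles if its edges join the ends of
the darts. -/
def IsSkeleton (Y : TriSystem V E) (G : SimpleGraph V) : Prop :=
  ∀ u v, G.Adj u v ↔ u ≠ v ∧ ∃ a, Y.src a = u ∧ Y.tgt a = v

namespace CoverEdge

theorem eq_or_adj (hG : Y.IsSkeleton G) {x y : Y.Cover o} {a : E} (h : Y.CoverEdge x a y) :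
    x.proj = y.proj ∨ G.Adj x.proj y.proj := by
  by_cases hxy : x.proj = y.proj
  · exact .inl hxy
  · exact .inr ((hG _ _).mpr ⟨hxy, a, h.src_eq, h.tgt_eq⟩)

theorem exists_of_adj (hG : Y.IsSkeleton G) {x : Y.Cover o} {v : V} (h : G.Adj x.proj v) :
    ∃ a y, Y.CoverEdge x a y ∧ y.proj = v := by
  obtain ⟨-, a, ha, rfl⟩ := (hG _ _).mp h
  obtain ⟨y, hy⟩ := exists_of_src_eq x ha
  exact ⟨a, y, hy, hy.tgt_eq.symm⟩

end CoverEdge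

theorem Cover.dist_le_level (hG : Y.IsSkeleton G) (hconn : G.Connected) (x : Y.Cover o) :
    G.dist o x.proj ≤ x.1 := by
  obtain ⟨n, w⟩ := x
  induction n with
  | zero => exact (SimpleGraph.dist_self (G := G) (v := o)).le
  | succ n ih =>
    obtain ⟨w', a, h⟩ := exists_up w
    have h1 := ih w'
    have h2 : G.dist (Cover.proj (⟨n, w'⟩ : Y.Cover o))
        (Cover.proj (⟨n + 1, w⟩ : Y.Cover o)) ≤ 1 := by
      rcases (CoverEdge.up h).eq_or_adj hG with h' | h'
      · rw [h', SimpleGraph.dist_self]; omega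
      · exact (SimpleGraph.dist_eq_one_iff_adj.mpr h').le
    have h3 := hconn.dist_triangle (u := o) (v := Cover.proj (⟨n, w'⟩ : Y.Cover o))
      (w := Cover.proj (⟨n + 1, w⟩ : Y.Cover o))
    dsimp only at *
    omega

/-- Lift a geodesic from `o`: the level of its end is at most its length, and at least the distance
because the covering map does not increase distances. -/
theorem Cover.exists_level_eq (hG : Y.IsSkeleton G) (hconn : G.Connected) (v : V) :
    ∃ w : (Y.sphere o (G.dist o v)).S, Cover.proj (⟨G.dist o v, w⟩ : Y.Cover o) = v := by
  have key : ∀ {u v : V} (p : G.Walk u v) (x : Y.Cover o), x.proj = u →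
      ∃ y : Y.Cover o, y.proj = v ∧ y.1 ≤ x.1 + p.length := by
    intro u v p
    induction p with
    | nil => exact fun x hx => ⟨x, hx, le_rfl⟩
    | cons h p ih =>
      rintro x rfl
      obtain ⟨a, y, hy, hyv⟩ := CoverEdge.exists_of_adj hG h
      obtain ⟨z, hz, hle⟩ := ih y hyv
      refine ⟨z, hz, hle.trans ?_⟩
      have := hy.level_le
      rw [SimpleGraph.Walk.length_cons]
      omega
  obtain ⟨p, hp⟩ := hconn.exists_walk_length_eq_dist o v
  obtain ⟨⟨n, w⟩, hy, hle⟩ := key p ⟨0, PUnit.unit⟩ rfl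
  have := Cover.dist_le_level hG hconn (⟨n, w⟩ : Y.Cover o)
  rw [hy] at this
  obtain rfl : n = G.dist o v := by
    dsimp only at *
    omega
  exact ⟨w, hy⟩

theorem CoverEdge.Q {n : ℕ} {w w' : (Y.sphere o n).S} {a : E}
    (h : Y.CoverEdge ⟨n, w⟩ a ⟨n, w'⟩) : (Y.sphere o n).Q w a w' := by
  cases h with
  | sib h => exact h

theorem CoverEdge.Up {n : ℕ} {w : (Y.sphere o n).S} {z : (Y.sphere o (n + 1)).S} {a : E}
    (h : Y.CoverEdge ⟨n, w⟩ a ⟨n + 1, z⟩) : (Y.sphere o n).Up w a z := by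
  cases h with
  | up h => exact h

/-- The universal covering map is injective for all base points. -/
def CoversInjectively (Y : TriSystem V E) : Prop :=
  ∀ o, Function.Injective (Cover.proj : Y.Cover o → V)

theorem CoversInjectively.exists_edge (hinj : Y.CoversInjectively) (hG : Y.IsSkeleton G)
    {x y : Y.Cover o} (h : G.Adj x.proj y.proj) : ∃ a, Y.CoverEdge x a y := by
  obtain ⟨a, z, hz, hzy⟩ := CoverEdge.exists_of_adj hG h
  exact ⟨a, hinj o hzy ▸ hz⟩

/-- The neighbours of a vertex which are closer to the base point are adjacent. -/
theorem CoversInjectively.parents_adj (hinj : Y.CoversInjectively) (hG : Y.IsSkeleton G)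
    (hconn : G.Connected) {n : ℕ} {x y z : V} (hx : G.dist o x = n) (hy : G.dist o y = n)
    (hz : G.dist o z = n + 1) (hxz : G.Adj x z) (hyz : G.Adj y z) : x = y ∨ G.Adj x y := by
  obtain ⟨x', hx'⟩ := Cover.exists_level_eq (o := o) hG hconn x
  obtain ⟨y', hy'⟩ := Cover.exists_level_eq (o := o) hG hconn y
  obtain ⟨z', hz'⟩ := Cover.exists_level_eq (o := o) hG hconn z
  -- The types of `x'`, `y'`, `z'` depend on the levels, so these must become variables before they
  -- can be replaced.
  generalize G.dist o x = n₁ at *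
  generalize G.dist o y = n₂ at *
  generalize G.dist o z = n₃ at *
  subst hx hy hz
  obtain ⟨a, ha⟩ := hinj.exists_edge hG (hx'.symm ▸ hz'.symm ▸ hxz)
  obtain ⟨b, hb⟩ := hinj.exists_edge hG (hy'.symm ▸ hz'.symm ▸ hyz)
  rcases ha.Up.cases hb.Up with ⟨rfl, -⟩ | ⟨c, hc, -⟩
  · exact .inl (hx'.symm.trans hy')
  · have := (CoverEdge.sib hc).eq_or_adj hG
    rwa [hx', hy'] at this

/-- Adjacent vertices at the same distance from the base point have a common neighbour closer
to it. -/
theorem CoversInjectively.exists_parent (hinj : Y.CoversInjectively) (hG : Y.IsSkeleton G)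
    (hconn : G.Connected) {n : ℕ} {x y : V} (hx : G.dist o x = n + 1) (hy : G.dist o y = n + 1)
    (hxy : G.Adj x y) : ∃ p, G.dist o p = n ∧ G.Adj p x ∧ G.Adj p y := by
  obtain ⟨x', hx'⟩ := Cover.exists_level_eq (o := o) hG hconn x
  obtain ⟨y', hy'⟩ := Cover.exists_level_eq (o := o) hG hconn y
  generalize hn₁ : G.dist o x = n₁ at *
  generalize hn₂ : G.dist o y = n₂ at *
  subst hx hy
  obtain ⟨a, ha⟩ := hinj.exists_edge hG (hx'.symm ▸ hy'.symm ▸ hxy)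
  obtain ⟨w, b, c, hb, hc, -⟩ := ha.Q
  have hle := Cover.dist_le_level hG hconn (⟨n, w⟩ : Y.Cover o)
  have h1 := (CoverEdge.up hb).eq_or_adj hG
  have h2 := (CoverEdge.up hc).eq_or_adj hG
  rw [hx'] at h1
  rw [hy'] at h2
  dsimp only at hle
  have adj : ∀ {v}, G.dist o v = n + 1 → ∀ {u}, G.dist o u ≤ n → u = v ∨ G.Adj u v →
      G.Adj u v ∧ G.dist o u = n := by
    rintro v hv u hu (rfl | h)
    · omega
    · have := h.diff_dist_adj (u := o)
      exact ⟨h, by omega⟩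
  exact ⟨_, (adj hn₁ hle h1).2, (adj hn₁ hle h1).1, (adj hn₂ hle h2).1⟩

/-- Two adjacent neighbours of the base point span a triangle with it. -/
theorem CoversInjectively.exists_triangle (hinj : Y.CoversInjectively) (hG : Y.IsSkeleton G)
    {x y : V} {a b : E} (hxy : G.Adj x y) (ha : Y.src a = o) (hb : Y.src b = o)
    (hx : Y.tgt a = x) (hy : Y.tgt b = y) : ∃ c, Y.L a b c := by
  have new : ∀ {a}, Y.src a = o → (root Y o).New PUnit.unit a := fun h => ⟨h, id, fun _ => id⟩
  obtain ⟨x', hx'⟩ := (new ha).exists_up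
  obtain ⟨y', hy'⟩ := (new hb).exists_up
  have hx'' : Cover.proj (⟨0 + 1, x'⟩ : Y.Cover o) = x := hx'.φ_eq.trans hx
  have hy'' : Cover.proj (⟨0 + 1, y'⟩ : Y.Cover o) = y := hy'.φ_eq.trans hy
  obtain ⟨d, hd⟩ := hinj.exists_edge hG (hx''.symm ▸ hy''.symm ▸ hxy)
  obtain ⟨w, a', b', ha', hb', hL⟩ := hd.Q
  obtain rfl := hx'.label ha'
  obtain rfl := hy'.label hb'
  exact ⟨_, hL⟩

/-- The neighbourhood of a vertex contains no isometric pentagon. -/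
theorem CoversInjectively.not_five (hinj : Y.CoversInjectively) (hG : Y.IsSkeleton G)
    {c : SimpleGraph.cycleGraph 5 →g G}
    (hc : ∀ i j, G.dist (c i) (c j) = (SimpleGraph.cycleGraph 5).dist i j) :
    ¬ ∀ i, G.Adj o (c i) := by
  have h₁ : ∀ i, G.Adj (c i) (c (i + 1)) := fun i =>
    c.map_adj (by rw [SimpleGraph.cycleGraph_adj]; right; exact add_sub_cancel_left i 1)
  have hdist : ∀ i, G.dist (c i) (c (i + 2)) = 2 := by
    have key : ∀ i j : Fin 5, i ≤ j → (j : ℕ) - i = 2 ∨ (j : ℕ) - i = 3 →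
        G.dist (c i) (c j) = 2 := fun i j hij h => by
      rw [hc, SimpleGraph.cycleGraph_dist hij]
      omega
    intro i
    by_cases h : i ≤ i + 2
    · exact key _ _ h (by revert i; decide)
    · rw [SimpleGraph.dist_comm]
      exact key _ _ (le_of_not_ge h) (by revert i; decide)
  have h₂ : ∀ i, ¬ G.Adj (c i) (c (i + 2)) := fun i h => by
    have := hdist i
    rw [SimpleGraph.dist_eq_one_iff_adj.mpr h] at this
    omega
  have h₃ : ∀ i, c i ≠ c (i + 2) := fun i h => by
    have := hdist i
    rw [h, SimpleGraph.dist_self] at this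
    omega
  intro ho
  choose a ha using fun i => ((hG _ _).mp (ho i)).2
  have link : ∀ i, ∃ x, Y.L (a i) (a (i + 1)) x := fun i =>
    hinj.exists_triangle hG (h₁ i) (ha i).1 (ha _).1 (ha i).2 (ha _).2
  have hne : ∀ i, a i ≠ a (i + 2) := fun i h => h₃ i (by rw [← (ha i).2, h, (ha _).2])
  have hlink : ∀ i, ¬ ∃ x, Y.L (a i) (a (i + 2)) x := by
    rintro i ⟨x, hx⟩
    exact h₂ i ((hG _ _).mpr ⟨h₃ i, x, (Y.src_third hx).trans (ha i).2,
      (Y.tgt_third hx).trans (ha _).2⟩)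
  have hlink' : ∀ i, ¬ ∃ x, Y.L (a (i + 2)) (a i) x := fun i ⟨x, hx⟩ => hlink i ⟨_, Y.swap hx⟩
  -- The diagonals run from `i` to `i + 2` modulo 5, so those starting at 3 and 4 occur reversed.
  rcases Y.five (link 0) (link 1) (link 2) (link 3) (link 4) (hne 0) (hne 3).symm (hne 1)
    (hne 4).symm (hne 2) with h | h | h | h | h
  · exact hlink 0 h
  · exact hlink' 3 h
  · exact hlink 1 h
  · exact hlink' 4 h
  · exact hlink 2 h

/-- An edge of a sphere whose ends have distinct parents has a parent which is adjacent to them. -/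
theorem CoversInjectively.exists_common_neighbor (hinj : Y.CoversInjectively)
    (hG : Y.IsSkeleton G) (hconn : G.Connected) {n : ℕ} {a x y b : V} (ha : G.dist o a = n)
    (hx : G.dist o x = n + 1) (hy : G.dist o y = n + 1) (hb : G.dist o b = n) (hax : G.Adj a x)
    (hxy : G.Adj x y) (hyb : G.Adj y b) (hay : G.dist a y = 2) (hxb : G.dist x b = 2) :
    ∃ q, G.dist o q = n ∧ G.Adj q a ∧ G.Adj q x ∧ G.Adj q y ∧ G.Adj q b := by
  obtain ⟨q, hq, hqx, hqy⟩ := hinj.exists_parent hG hconn hx hy hxy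
  refine ⟨q, hq, (hinj.parents_adj hG hconn hq ha hx hqx hax).resolve_left ?_, hqx, hqy,
    (hinj.parents_adj hG hconn hq hb hy hqy hyb.symm).resolve_left ?_⟩
  · rintro rfl
    rw [SimpleGraph.dist_eq_one_iff_adj.mpr hqy] at hay
    omega
  · rintro rfl
    rw [SimpleGraph.dist_comm, SimpleGraph.dist_eq_one_iff_adj.mpr hqx] at hxb
    omega

/-- A local-to-global principle: the `1`-skeleton of a system of darts and triangles which is its
own universal cover is bridged. -/
theorem CoversInjectively.isBridged (hinj : Y.CoversInjectively) (hG : Y.IsSkeleton G)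
    (hconn : G.Connected) : IsBridged G := by
  refine ⟨hconn, fun n hn c hc => ?_⟩
  by_contra hn3
  have hdist : ∀ (i j : ℕ) (hi : i < n) (hj : j < n), i ≤ j →
      G.dist (c ⟨i, hi⟩) (c ⟨j, hj⟩) = min (j - i) (n - (j - i)) := fun i j hi hj hij => by
    rw [hc, SimpleGraph.cycleGraph_dist (Fin.le_def.mpr hij)]
  have hadj : ∀ (i j : ℕ) (hi : i < n) (hj : j < n), j = i + 1 →
      G.Adj (c ⟨i, hi⟩) (c ⟨j, hj⟩) := fun i j hi hj hij =>
    c.map_adj (SimpleGraph.cycleGraph_adj_of_succ hij)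
  obtain ⟨m, rfl | rfl⟩ := Nat.even_or_odd' n
  -- Length `2 * m` with base point `c 0`: the vertices `m - 1` and `m + 1` are parents of the
  -- antipode `m`, but lie at distance 2 from each other.
  · have h1 := hdist 0 (m - 1) (by omega) (by omega) (by omega)
    have h2 := hdist 0 (m + 1) (by omega) (by omega) (by omega)
    have h3 := hdist 0 m (by omega) (by omega) (by omega)
    have h4 := hdist (m - 1) (m + 1) (by omega) (by omega) (by omega)
    rcases hinj.parents_adj hG hconn (n := m - 1) (h1.trans (by omega)) (h2.trans (by omega))
      (h3.trans (by omega)) (hadj _ _ _ _ (by omega)) (hadj _ _ _ _ (by omega)).symm with h | h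
    · rw [h, SimpleGraph.dist_self] at h4
      omega
    · rw [SimpleGraph.dist_eq_one_iff_adj.mpr h] at h4
      omega
  -- Length `2 * k + 5` with base point `c 0`: the edge from `k + 2` to `k + 3` is farthest away.
  -- Its parent `q` is adjacent to the vertices `k + 1` and `k + 4`, whose distance `min 3 (2 * k +
  -- 2)` is therefore at most 2. So `k = 0`, and `q` is adjacent to `c 0` as well.
  · obtain ⟨k, rfl⟩ : ∃ k, m = k + 2 := ⟨m - 2, by omega⟩
    have hd : ∀ {i j d : ℕ} (hi : i < 2 * (k + 2) + 1) (hj : j < 2 * (k + 2) + 1), i ≤ j →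
        min (j - i) (2 * (k + 2) + 1 - (j - i)) = d → G.dist (c ⟨i, hi⟩) (c ⟨j, hj⟩) = d :=
      fun hi hj hij h => (hdist _ _ hi hj hij).trans h
    obtain ⟨q, hq, hqa, hqx, hqy, hqb⟩ := hinj.exists_common_neighbor hG hconn (n := k + 1)
      (hd (i := 0) (j := k + 1) (by omega) (by omega) (by omega) (by omega))
      (hd (i := 0) (j := k + 2) (by omega) (by omega) (by omega) (by omega))
      (hd (i := 0) (j := k + 3) (by omega) (by omega) (by omega) (by omega))
      (hd (i := 0) (j := k + 4) (by omega) (by omega) (by omega) (by omega))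
      (hadj _ _ _ _ rfl) (hadj _ _ _ _ rfl) (hadj _ _ _ _ rfl)
      (hd (by omega) (by omega) (by omega) (by omega))
      (hd (by omega) (by omega) (by omega) (by omega))
    have h := hconn.dist_triangle (u := c ⟨k + 1, by omega⟩) (v := q) (w := c ⟨k + 4, by omega⟩)
    rw [SimpleGraph.dist_eq_one_iff_adj.mpr hqa.symm, SimpleGraph.dist_eq_one_iff_adj.mpr hqb,
      hdist _ _ _ _ (by omega)] at h
    obtain rfl : k = 0 := by omega
    rw [SimpleGraph.dist_comm, SimpleGraph.dist_eq_one_iff_adj] at hq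
    exact hinj.not_five hG hc
      (Fin.forall_fin_succ.mpr ⟨hq, Fin.forall_fin_succ.mpr ⟨hqa, Fin.forall_fin_succ.mpr ⟨hqx,
        Fin.forall_fin_succ.mpr ⟨hqy, Fin.forall_fin_one.mpr hqb⟩⟩⟩⟩)

end TriSystem

/-! ### Immersed cycles through two given edges at a vertex. -/

namespace Graphical

section Turns

variable {W : Type*} {Ω : SimpleGraph W}

/-- The oriented edge `e` follows the oriented edge `d` without backtracking. -/
structure Turn (Ω : SimpleGraph W) (d e : W × W) : Prop where
  eq : d.2 = e.1
  ne : d.1 ≠ e.2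
  adj₁ : Ω.Adj d.1 d.2
  adj₂ : Ω.Adj e.1 e.2

theorem Turn.swap {d e : W × W} (h : Turn Ω d e) : Turn Ω e.swap d.swap :=
  ⟨h.eq.symm, h.ne.symm, h.adj₂.symm, h.adj₁.symm⟩

/-- `Turns Ω n d e`: there is an immersed path with `n + 1` edges, the first being `d` and the last
being `e`. -/
inductive Turns (Ω : SimpleGraph W) : ℕ → W × W → W × W → Prop
  | refl (d) : Turns Ω 0 d d
  | tail {n d e e'} : Turns Ω n d e → Turn Ω e e' → Turns Ω (n + 1) d e'

namespace Turns

theorem trans {m n : ℕ} {d e e' : W × W} (h : Turns Ω m d e) (h' : Turns Ω n e e') :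
    Turns Ω (m + n) d e' := by
  induction h' with
  | refl => exact h
  | tail _ ht ih => exact (ih h).tail ht

theorem head {n : ℕ} {d e e' : W × W} (h : Turn Ω d e) (h' : Turns Ω n e e') :
    Turns Ω (1 + n) d e' :=
  ((Turns.refl d).tail h).trans h'

theorem swap {n : ℕ} {d e : W × W} (h : Turns Ω n d e) : Turns Ω n e.swap d.swap := by
  induction h with
  | refl => exact .refl _
  | tail _ ht ih => exact Nat.add_comm _ 1 ▸ head ht.swap ih

/-- Strip common last edges from the two paths. Either they fork, and turning around at the fork
joins `p` to the reverse of `q`, or one path is a final segment of the other. -/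
theorem merge {m n : ℕ} {p q x : W × W} (hp : Turns Ω m p x) (hq : Turns Ω n q x) :
    (∃ k, Turns Ω k p q.swap) ∨ (∃ k, n = m + k ∧ Turns Ω k q p) ∨
      ∃ k, m = n + k ∧ Turns Ω k p q := by
  induction hp generalizing n with
  | refl => exact .inr (.inl ⟨n, (Nat.zero_add n).symm, hq⟩)
  | @tail m p x' x hp hx ih =>
    cases hq with
    | refl => exact .inr (.inr ⟨m + 1, (Nat.zero_add _).symm, hp.tail hx⟩)
    | @tail n _ x'' _ hq hx' =>
      by_cases h : x' = x''
      · subst h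
        rcases ih hq with h | ⟨k, rfl, h⟩ | ⟨k, rfl, h⟩
        · exact .inl h
        · exact .inr (.inl ⟨k, by omega, h⟩)
        · exact .inr (.inr ⟨k, by omega, h⟩)
      · left
        have ht : Turn Ω x' x''.swap := ⟨hx.eq.trans hx'.eq.symm,
          fun h' => h (Prod.ext h' (hx.eq.trans hx'.eq.symm)), hx.adj₁, hx'.adj₁.symm⟩
        exact ⟨_, (hp.tail ht).trans hq.swap⟩

/-- In a graph in which every edge is traversed by an immersed cycle, any two edges at a vertex
are successive edges of an immersed cycle. -/
theorem exists_of_adj (hcyc : ∀ a b, Ω.Adj a b → ∃ n, Turns Ω (n + 1) (a, b) (a, b))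
    {a b w : W} (ha : Ω.Adj a w) (hb : Ω.Adj w b) (hab : a ≠ b) :
    ∃ n, Turns Ω n (w, b) (a, w) := by
  classical
  have ex : ∀ b, Ω.Adj w b → ∃ n s, s ≠ b ∧ Ω.Adj s w ∧ Turns Ω n (w, b) (s, w) := by
    intro b hb
    obtain ⟨n, h⟩ := hcyc w b hb
    cases h with
    | @tail _ _ e _ h ht =>
      obtain ⟨s, w'⟩ := e
      obtain rfl : w' = w := ht.eq
      exact ⟨n, s, ht.ne, ht.adj₁, h⟩
  -- Take shortest immersed paths that leave `w` along `b`, respectively `a`, and come back to `w`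
  -- by a different edge. If their last edges differ, the first path followed by the reverse of the
  -- second is the desired one.
  obtain ⟨s, hs, hsw, hm⟩ := Nat.find_spec (ex b hb)
  obtain ⟨s', hs', hsw', hn⟩ := Nat.find_spec (ex a ha.symm)
  have minb := fun {j : ℕ} => Nat.find_min (ex b hb) (m := j)
  have mina := fun {j : ℕ} => Nat.find_min (ex a ha.symm) (m := j)
  generalize Nat.find (ex b hb) = m at *
  generalize Nat.find (ex a ha.symm) = n at *
  by_cases hss : s = s'
  · subst hss
    have last : ∀ {c d k}, c ≠ d → Turns Ω k (w, c) (w, d) → ∃ j r, k = j + 1 ∧ r ≠ d ∧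
        Ω.Adj r w ∧ Turns Ω j (w, c) (r, w) := by
      intro c d k hcd h
      cases h with
      | refl => exact (hcd rfl).elim
      | @tail j _ e _ h ht =>
        obtain ⟨r, w'⟩ := e
        obtain rfl : w' = w := ht.eq
        exact ⟨j, r, rfl, ht.ne, ht.adj₁, h⟩
    -- With equal last edges the paths either fork, or one contains the other as a final segment.
    -- Then the longer one has visited `w` before: by minimality this earlier return is along its
    -- own first edge reversed, and the two loops can be composed.
    rcases hm.merge hn with h | ⟨k, rfl, h⟩ | ⟨k, rfl, h⟩
    · exact h
    · obtain ⟨j, r, rfl, hr, hrw, h⟩ := last hab h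
      by_cases hra : r = a
      · subst hra
        exact ⟨_, (hm.tail ⟨rfl, hs', hsw, ha.symm⟩).trans h⟩
      · exact (mina (by omega) ⟨r, hra, hrw, h⟩).elim
    · obtain ⟨j, r, rfl, hr, hrw, h⟩ := last hab.symm h
      by_cases hrb : r = b
      · subst hrb
        exact ⟨_, (h.tail ⟨rfl, hs.symm, hb.symm, hsw.symm⟩).trans hn.swap⟩
      · exact (minb (by omega) ⟨r, hrb, hrw, h⟩).elim
  · exact ⟨_, (hm.tail ⟨rfl, hss, hsw, hsw'.symm⟩).trans hn.swap⟩

theorem exists_seq {n : ℕ} {d e : W × W} (h : Turns Ω n d e) :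
    ∃ g : ℕ → W × W, g 0 = d ∧ g n = e ∧ ∀ i < n, Turn Ω (g i) (g (i + 1)) := by
  induction h with
  | refl d => exact ⟨fun _ => d, rfl, rfl, fun i hi => (Nat.not_lt_zero i hi).elim⟩
  | @tail n d e e' h ht ih =>
    obtain ⟨g, h0, hn, hg⟩ := ih
    refine ⟨fun i => if i ≤ n then g i else e', by simp [h0], by simp, fun i hi => ?_⟩
    rcases Nat.lt_succ_iff_lt_or_eq.mp hi with hi | rfl
    · simpa [hi.le, Nat.succ_le_of_lt hi] using hg i hi
    · simpa [hn] using ht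

end Turns

/-- `γ` runs periodically through an immersed cycle of length `N`. -/
structure IsPeriodicImmersion (Ω : SimpleGraph W) (γ : ℕ → W) (N : ℕ) : Prop where
  pos : 0 < N
  adj : ∀ i, Ω.Adj (γ i) (γ (i + 1))
  ne : ∀ i, γ i ≠ γ (i + 2)
  period : ∀ i, γ (i + N) = γ i

theorem Turns.exists_immersion {n : ℕ} {a b w : W} (h : Turns Ω n (w, b) (a, w))
    (ha : Ω.Adj a w) (hb : Ω.Adj w b) (hab : a ≠ b) :
    ∃ γ, IsPeriodicImmersion Ω γ (n + 1) ∧ γ 0 = w ∧ γ 1 = b ∧ γ n = a := by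
  obtain ⟨g, h0, hn, hg⟩ := h.exists_seq
  have key : ∀ i, Turn Ω (g (i % (n + 1))) (g ((i + 1) % (n + 1))) := by
    intro i
    have hi : i % (n + 1) < n + 1 := Nat.mod_lt i (Nat.succ_pos n)
    rcases Nat.lt_succ_iff_lt_or_eq.mp hi with hi | hi
    · have : (i + 1) % (n + 1) = i % (n + 1) + 1 := by
        rw [← Nat.mod_add_mod, Nat.mod_eq_of_lt (by omega)]
      rw [this]
      exact hg _ hi
    · have : (i + 1) % (n + 1) = 0 := by
        rw [← Nat.mod_add_mod, hi, Nat.mod_self]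
      rw [this, hi, hn, h0]
      exact ⟨rfl, hab, ha, hb⟩
  refine ⟨fun i => (g (i % (n + 1))).1, ⟨Nat.succ_pos n, fun i => ?_, fun i => ?_, fun i => ?_⟩,
    by simp [h0], ?_, ?_⟩
  · rw [← (key i).eq]
    exact (key i).adj₁
  · rw [← (key (i + 1)).eq]
    exact (key i).ne
  · simp
  · have := (key 0).eq
    simpa [h0] using this.symm
  · simp [hn]

/-- Running twice through the cycle leads each dart to its next occurrence without backtracking,
also across the base point. The given edge may be traversed backwards, whence the reversal at the
end. -/
theorem IsImmersedCycle.turns {w : W} {c : Ω.Walk w w} (hc : IsImmersedCycle c) {a b : W}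
    (h : s(a, b) ∈ c.edges) : ∃ n, Turns Ω (n + 1) (a, b) (a, b) := by
  set q := c.append c with hq
  have hlen : q.length = c.length + c.length := SimpleGraph.Walk.length_append _ _
  have hg : ∀ i ≤ c.length, q.getVert (i + c.length) = q.getVert i := by
    intro i hi
    rw [hq, SimpleGraph.Walk.getVert_append, SimpleGraph.Walk.getVert_append', if_neg (by omega),
      if_pos hi, Nat.add_sub_cancel]
  have ht : ∀ i, i + 2 ≤ q.length →
      Turn Ω (q.getVert i, q.getVert (i + 1)) (q.getVert (i + 1), q.getVert (i + 2)) := by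
    intro i hi
    refine ⟨rfl, ?_, q.adj_getVert_succ (by omega), q.adj_getVert_succ (by omega)⟩
    have := hc.2 i (by rw [SimpleGraph.Walk.length_support, ← hq]; omega)
    rwa [SimpleGraph.Walk.support_getElem_eq_getVert,
      SimpleGraph.Walk.support_getElem_eq_getVert] at this
  have hts : ∀ k i, i + k + 1 ≤ q.length → Turns Ω k (q.getVert i, q.getVert (i + 1))
      (q.getVert (i + k), q.getVert (i + k + 1)) := by
    intro k i
    induction k with
    | zero => exact fun _ => .refl _
    | succ k ih => exact fun hi => (ih (by omega)).tail (ht (i + k) (by omega))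
  have key : ∀ d ∈ c.darts, Turns Ω c.length d.toProd d.toProd := by
    intro d hd
    obtain ⟨i, hi, rfl⟩ := List.getElem_of_mem hd
    have hi' : i < c.length := by rwa [SimpleGraph.Walk.length_darts] at hi
    have := hts c.length i (by omega)
    rw [hg i hi'.le, Nat.add_right_comm, hg (i + 1) hi', hq, SimpleGraph.Walk.getVert_append',
      SimpleGraph.Walk.getVert_append', if_pos hi'.le, if_pos (Nat.succ_le_of_lt hi')] at this
    rw [SimpleGraph.Walk.darts_getElem_eq_getVert]
    exact this
  obtain ⟨n, hn⟩ := Nat.exists_eq_succ_of_ne_zero hc.1.ne'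
  obtain ⟨d, hd, he⟩ := List.mem_map.mp h
  have := key d hd
  rw [hn] at this
  refine ⟨n, ?_⟩
  rcases SimpleGraph.dart_edge_eq_mk'_iff.mp he with h | h
  · rwa [h] at this
  · have h' := this.swap
    rwa [h] at h'

/-- In a graph in which every edge is traversed by an immersed cycle, any two edges at a vertex
are successive edges of an immersed cycle. -/
theorem exists_immersion
    (hΩ : ∀ e ∈ Ω.edgeSet, ∃ (w : W) (c : Ω.Walk w w), IsImmersedCycle c ∧ e ∈ c.edges)
    {a b w : W} (ha : Ω.Adj w a) (hb : Ω.Adj w b) (hab : a ≠ b) :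
    ∃ γ n, IsPeriodicImmersion Ω γ (n + 1) ∧ γ 0 = w ∧ γ 1 = b ∧ γ n = a := by
  obtain ⟨n, h⟩ := Turns.exists_of_adj (fun x y hxy => by
    obtain ⟨w, c, hc, h⟩ := hΩ _ (SimpleGraph.mem_edgeSet Ω |>.mpr hxy)
    exact hc.turns h) ha.symm hb hab
  obtain ⟨γ, hγ⟩ := h.exists_immersion ha.symm hb hab
  exact ⟨γ, n, hγ⟩

end Turns

end Graphical

/-! ### Cycles of a permutation classified by an invariant. -/

namespace Equiv.Perm

variable {α T : Type*} {σ : Equiv.Perm α} {g : α → T} {r : T → α}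

theorem SameCycle.map_eq (hg : ∀ a, g (σ a) = g a) {a b : α} (h : σ.SameCycle a b) :
    g a = g b := by
  obtain ⟨n, rfl⟩ := h
  have hpow : ∀ (n : ℕ) a, g ((σ ^ n) a) = g a := fun n => by
    induction n with
    | zero => exact fun a => congrArg g (one_apply a)
    | succ n ih => exact fun a => by rw [pow_succ, mul_apply, ih, hg]
  rcases n with n | n
  · exact (hpow n a).symm
  · rw [zpow_negSucc, ← hpow (n + 1) ((σ ^ (n + 1))⁻¹ a), ← mul_apply, mul_inv_cancel, one_apply]

/-- The invariant `g` labels the cycles and `r` picks a representative for a label; this is how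
faces and vertices of the star are recognised. -/
theorem sameCycle_iff_of_invariant (hg : ∀ a, g (σ a) = g a)
    (hr : ∀ a, σ.SameCycle a (r (g a))) {a b : α} : σ.SameCycle a b ↔ g a = g b :=
  ⟨SameCycle.map_eq hg, fun h => (hr a).trans (h ▸ (hr b).symm)⟩

theorem card_quotient_sameCycle (hg : ∀ a, g (σ a) = g a) (hr : ∀ a, σ.SameCycle a (r (g a)))
    (hgr : ∀ t, g (r t) = t) : Nat.card (Quotient (SameCycle.setoid σ)) = Nat.card T :=
  Nat.card_congr
    { toFun := Quotient.lift g fun _ _ => SameCycle.map_eq hg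
      invFun := fun t => Quotient.mk _ (r t)
      left_inv := fun q => by
        induction q using Quotient.inductionOn with
        | h a => exact Quotient.sound (hr a).symm
      right_inv := hgr }

theorem sameCycle_apply_self (σ : Equiv.Perm α) (a : α) : σ.SameCycle a (σ a) :=
  sameCycle_apply_right.mpr (SameCycle.refl _ _)

end Equiv.Perm

/-! ### The star of polygons as a cell structure on the sphere. -/

namespace Graphical

/-- The darts of a star of `k` polygons with `m + 3` sides around a vertex: `out i` and `inn i` are
the darts of the `i`-th polygon which leave and enter the centre, `rim i j` are its other darts,
and `orim i j` are their reverses, on the boundary of the star. -/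
inductive StarDart (k m : ℕ) : Type
  | out (i : ZMod k)
  | inn (i : ZMod k)
  | rim (i : ZMod k) (j : Fin (m + 1))
  | orim (i : ZMod k) (j : Fin (m + 1))

namespace StarDart

variable {k m : ℕ}

/-- The darts of the star as a sum type. -/
def equivSum : StarDart k m ≃
    (ZMod k ⊕ ZMod k) ⊕ (ZMod k × Fin (m + 1)) ⊕ (ZMod k × Fin (m + 1)) where
  toFun
    | out i => .inl (.inl i)
    | inn i => .inl (.inr i)
    | rim i j => .inr (.inl (i, j))
    | orim i j => .inr (.inr (i, j))
  invFun
    | .inl (.inl i) => out i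
    | .inl (.inr i) => inn i
    | .inr (.inl (i, j)) => rim i j
    | .inr (.inr (i, j)) => orim i j
  left_inv := by rintro (i | i | i | i) <;> rfl
  right_inv := by rintro ((i | i) | (i | i)) <;> rfl

instance [NeZero k] : Finite (StarDart k m) := Finite.of_equiv _ equivSum.symm

theorem card [NeZero k] : Nat.card (StarDart k m) = 2 * k + 2 * (k * (m + 1)) := by
  rw [Nat.card_congr equivSum]
  simp only [Nat.card_sum, Nat.card_prod, Nat.card_zmod, Nat.card_fin]
  ring

/-- The reversal of darts of the star. -/
def rev : Equiv.Perm (StarDart k m) where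
  toFun
    | out i => inn (i + 1)
    | inn i => out (i - 1)
    | rim i j => orim i j
    | orim i j => rim i j
  invFun
    | out i => inn (i + 1)
    | inn i => out (i - 1)
    | rim i j => orim i j
    | orim i j => rim i j
  left_inv := by rintro (i | i | i | i) <;> simp
  right_inv := by rintro (i | i | i | i) <;> simp

/-- The dart following on the boundary of a face of the star. -/
def next : StarDart k m → StarDart k m
  | out i => rim i 0
  | inn i => out i
  | rim i j => if h : (j : ℕ) < m then rim i ⟨j + 1, by omega⟩ else inn i
  | orim i j => if (j : ℕ) = 0 then orim (i + 1) (Fin.last m) else orim i ⟨j - 1, by omega⟩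

/-- The dart preceding on the boundary of a face of the star. -/
def prev : StarDart k m → StarDart k m
  | out i => inn i
  | inn i => rim i (Fin.last m)
  | rim i j => if (j : ℕ) = 0 then out i else rim i ⟨j - 1, by omega⟩
  | orim i j => if h : (j : ℕ) < m then orim i ⟨j + 1, by omega⟩ else orim (i - 1) 0

/-- The face permutation of the star. -/
def faceNext : Equiv.Perm (StarDart k m) where
  toFun := next
  invFun := prev
  left_inv := by
    rintro (i | i | ⟨i, j⟩ | ⟨i, j⟩)
    · simp [next, prev]
    · simp [next, prev]
    · by_cases h : (j : ℕ) < m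
      · simp [next, prev, h]
      · simp only [next, prev, h, dite_false, rim.injEq, true_and]
        exact Fin.ext (by simp; omega)
    · by_cases h : (j : ℕ) = 0
      · simp only [next, prev, h, if_true, Fin.val_last, lt_irrefl, dite_false, orim.injEq]
        exact ⟨add_sub_cancel_right _ _, Fin.ext h.symm⟩
      · have : (j : ℕ) - 1 < m := by omega
        simp only [next, prev, h, if_false, this, dite_true, orim.injEq, true_and]
        exact Fin.ext (by simp; omega)
  right_inv := by
    rintro (i | i | ⟨i, j⟩ | ⟨i, j⟩)
    · simp [next, prev]
    · simp [next, prev]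
    · by_cases h : (j : ℕ) = 0
      · simp only [next, prev, h, if_true, rim.injEq, true_and]
        exact Fin.ext h.symm
      · have : (j : ℕ) - 1 < m := by omega
        simp only [next, prev, h, if_false, this, dite_true, rim.injEq, true_and]
        exact Fin.ext (by simp; omega)
    · by_cases h : (j : ℕ) < m
      · simp [next, prev, h]
      · simp only [next, prev, h, dite_false, Fin.val_zero, if_true, orim.injEq]
        exact ⟨sub_add_cancel _ _, Fin.ext (by simp; omega)⟩

@[simp] theorem rev_out (i : ZMod k) : rev (out i : StarDart k m) = inn (i + 1) := rfl
@[simp] theorem rev_inn (i : ZMod k) : rev (inn i : StarDart k m) = out (i - 1) := rfl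
@[simp] theorem rev_rim (i : ZMod k) (j : Fin (m + 1)) : rev (rim i j) = orim i j := rfl
@[simp] theorem rev_orim (i : ZMod k) (j : Fin (m + 1)) : rev (orim i j) = rim i j := rfl

theorem faceNext_rim_of_lt {i : ZMod k} {j : Fin (m + 1)} (h : (j : ℕ) < m) :
    faceNext (rim i j) = rim i ⟨j + 1, by omega⟩ := dif_pos h

theorem faceNext_rim_of_eq {i : ZMod k} {j : Fin (m + 1)} (h : (j : ℕ) = m) :
    faceNext (rim i j) = inn i := dif_neg (by omega)

theorem faceNext_orim_of_eq {i : ZMod k} {j : Fin (m + 1)} (h : (j : ℕ) = 0) :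
    faceNext (orim i j) = orim (i + 1) (Fin.last m) := if_pos h

theorem faceNext_orim_of_ne {i : ZMod k} {j : Fin (m + 1)} (h : (j : ℕ) ≠ 0) :
    faceNext (orim i j) = orim i ⟨j - 1, by omega⟩ := if_neg h

/-- The face on the left of a dart; `none` is the removed face. -/
def face : StarDart k m → Option (ZMod k)
  | out i => some i
  | inn i => some i
  | rim i _ => some i
  | orim _ _ => none

theorem face_faceNext (d : StarDart k m) : (faceNext d).face = d.face := by
  rcases d with i | i | ⟨i, j⟩ | ⟨i, j⟩
  · rfl
  · rfl
  · by_cases h : (j : ℕ) < m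
    · rw [faceNext_rim_of_lt h]; rfl
    · rw [faceNext_rim_of_eq (by omega)]; rfl
  · by_cases h : (j : ℕ) = 0
    · rw [faceNext_orim_of_eq h]; rfl
    · rw [faceNext_orim_of_ne h]; rfl

/-- A dart on the boundary of a given face. -/
def ofFace : Option (ZMod k) → StarDart k m
  | some i => out i
  | none => orim 0 0

theorem induct_zmod [NeZero k] {p : ZMod k → Prop} (h0 : p 0) (h : ∀ i, p i → p (i + 1)) (i) :
    p i := by
  obtain ⟨n, rfl⟩ := ZMod.natCast_zmod_surjective i
  induction n with
  | zero => simpa using h0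
  | succ n ih => simpa using h _ ih

theorem sameCycle_face [NeZero k] (d : StarDart k m) : faceNext.SameCycle d (ofFace d.face) := by
  have step := Equiv.Perm.sameCycle_apply_self (faceNext (k := k) (m := m))
  have hrim : ∀ (i : ZMod k) (n : ℕ) (hn : n < m + 1),
      faceNext.SameCycle (out i) (rim i (⟨n, hn⟩ : Fin (m + 1))) := by
    intro i n
    induction n with
    | zero => exact fun _ => step (out i)
    | succ n ih =>
      intro hn
      have := step (rim i (⟨n, by omega⟩ : Fin (m + 1)))
      rw [faceNext_rim_of_lt (by simp; omega)] at this
      exact (ih _).trans this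
  have horim : ∀ (i : ZMod k) (n : ℕ) (hn : n < m + 1),
      faceNext.SameCycle (orim i (⟨n, hn⟩ : Fin (m + 1))) (orim i 0) := by
    intro i n
    induction n with
    | zero => exact fun _ => Equiv.Perm.SameCycle.refl _ _
    | succ n ih =>
      intro hn
      have := step (orim i (⟨n + 1, hn⟩ : Fin (m + 1)))
      rw [faceNext_orim_of_ne (by simp)] at this
      exact this.trans (ih _)
  rcases d with i | i | ⟨i, j⟩ | ⟨i, j⟩
  · exact Equiv.Perm.SameCycle.refl _ _
  · exact step (inn i)
  · exact (hrim i j j.2).symm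
  · refine (horim i j j.2).trans (induct_zmod (p := fun i => faceNext.SameCycle (orim i 0) _)
      (Equiv.Perm.SameCycle.refl _ _) (fun i hi => ?_) i)
    have := step (orim i (0 : Fin (m + 1)))
    rw [faceNext_orim_of_eq rfl] at this
    exact ((horim (i + 1) m (by omega)).symm.trans this.symm).trans hi

/-- The tail of a dart; `none` is the centre, `some (i, j)` is the tail of `orim i j`. -/
def tail : StarDart k m → Option (ZMod k × Fin (m + 1))
  | out _ => none
  | inn i => some (i, Fin.last m)
  | rim i j => if (j : ℕ) = 0 then some (i + 1, Fin.last m) else some (i, ⟨j - 1, by omega⟩)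
  | orim i j => some (i, j)

/-- A dart with a given tail. -/
def ofTail : Option (ZMod k × Fin (m + 1)) → StarDart k m
  | some x => orim x.1 x.2
  | none => out 0

/-- The rotation of darts about their tail. -/
abbrev vertexNext : Equiv.Perm (StarDart k m) := faceNext * rev

theorem vertexNext_inn (i : ZMod k) :
    vertexNext (inn i : StarDart k m) = rim (i - 1) 0 := rfl

theorem vertexNext_rim (i : ZMod k) (j : Fin (m + 1)) :
    vertexNext (rim i j) = faceNext (orim i j) := rfl

theorem vertexNext_orim (i : ZMod k) (j : Fin (m + 1)) :
    vertexNext (orim i j) = faceNext (rim i j) := rfl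

theorem tail_vertexNext (d : StarDart k m) : (vertexNext d).tail = d.tail := by
  rcases d with i | i | ⟨i, j⟩ | ⟨i, j⟩
  · rfl
  · simp [vertexNext_inn, tail]
  · rw [vertexNext_rim]
    by_cases h : (j : ℕ) = 0
    · rw [faceNext_orim_of_eq h]; simp [tail, h]
    · rw [faceNext_orim_of_ne h]; simp [tail, h]
  · rw [vertexNext_orim]
    by_cases h : (j : ℕ) < m
    · rw [faceNext_rim_of_lt h]; simp [tail]
    · rw [faceNext_rim_of_eq (by omega)]
      simp only [tail, Option.some.injEq, Prod.mk.injEq, true_and]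
      exact Fin.ext (by simp; omega)

theorem sameCycle_tail [NeZero k] (d : StarDart k m) :
    vertexNext.SameCycle d (ofTail d.tail) := by
  have step := Equiv.Perm.sameCycle_apply_self (vertexNext (k := k) (m := m))
  have hrim : ∀ (i : ZMod k) (j : Fin (m + 1)),
      vertexNext.SameCycle (rim i j) (ofTail (rim i j).tail) := by
    intro i j
    have := step (rim i j)
    rw [vertexNext_rim] at this
    by_cases h : (j : ℕ) = 0
    · rw [faceNext_orim_of_eq h] at this; simpa [tail, ofTail, h] using this
    · rw [faceNext_orim_of_ne h] at this; simpa [tail, ofTail, h] using this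
  rcases d with i | i | ⟨i, j⟩ | ⟨i, j⟩
  · exact induct_zmod (p := fun i => vertexNext.SameCycle (out i) (out 0 : StarDart k m))
      (Equiv.Perm.SameCycle.refl _ _) (fun i hi => (step (out i)).symm.trans hi) i
  · have := (step (inn i)).trans (hrim _ _)
    simpa [vertexNext_inn, tail] using this
  · exact hrim i j
  · exact Equiv.Perm.SameCycle.refl _ _

end StarDart

open StarDart in
/-- The cell structure on the sphere given by a star of polygons and its complement. -/
abbrev starMap (k m : ℕ) [NeZero k] : SphereMap where
  Dart := StarDart k m
  rev := rev
  faceNext := faceNext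
  rev_rev d := by rcases d with i | i | i | i <;> simp
  rev_ne d := by rcases d with i | i | i | i <;> simp
  connected := by
    have hmul : ∀ {d e e' : StarDart k m},
        (∃ g ∈ Subgroup.closure {rev, faceNext}, g d = e) →
        (∃ g ∈ Subgroup.closure {rev, faceNext}, g e = e') →
        ∃ g ∈ Subgroup.closure {rev, faceNext}, g d = e' := by
      rintro d e e' ⟨g, hg, rfl⟩ ⟨g', hg', rfl⟩
      exact ⟨g' * g, mul_mem hg' hg, rfl⟩
    have hinv : ∀ {d e : StarDart k m},
        (∃ g ∈ Subgroup.closure {rev, faceNext}, g d = e) →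
        ∃ g ∈ Subgroup.closure {rev, faceNext}, g e = d := by
      rintro d e ⟨g, hg, rfl⟩
      exact ⟨g⁻¹, inv_mem hg, g.symm_apply_apply d⟩
    have hrev : ∀ d : StarDart k m, ∃ g ∈ Subgroup.closure {rev, faceNext}, g d = rev d :=
      fun d => ⟨_, Subgroup.subset_closure (.inl rfl), rfl⟩
    have hface : ∀ d : StarDart k m, ∃ g ∈ Subgroup.closure {rev, faceNext},
        g d = ofFace d.face := fun d => by
      obtain ⟨n, hn⟩ := sameCycle_face d
      exact ⟨_, zpow_mem (Subgroup.subset_closure (.inr rfl)) n, hn⟩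
    have hout : ∀ i, ∃ g ∈ Subgroup.closure {rev, faceNext}, g (out i : StarDart k m) = out 0 :=
      induct_zmod ⟨1, one_mem _, rfl⟩ fun i hi =>
        hmul (hinv (hmul (hrev (out i)) (hface _))) hi
    have hall : ∀ d : StarDart k m, ∃ g ∈ Subgroup.closure {rev, faceNext}, g d = out 0 := by
      rintro (i | i | ⟨i, j⟩ | ⟨i, j⟩)
      · exact hout i
      · exact hmul (hface _) (hout i)
      · exact hmul (hface _) (hout i)
      · exact hmul (hmul (hrev _) (hface (rim i j))) (hout i)
    exact fun d e => hmul (hall d) (hinv (hall e))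
  euler := by
    -- There are `k * (m + 1) + 1` vertices, `k + 1` faces and `2 * k + 2 * (k * (m + 1))` darts.
    rw [Equiv.Perm.card_quotient_sameCycle tail_vertexNext sameCycle_tail
      (by rintro (_ | _) <;> rfl), Equiv.Perm.card_quotient_sameCycle face_faceNext sameCycle_face
      (by rintro (_ | _) <;> rfl), StarDart.card]
    simp only [Nat.card_eq_fintype_card, Fintype.card_option, Fintype.card_prod, ZMod.card,
      Fintype.card_fin]
    ring

open StarDart

variable {k m : ℕ} [NeZero k]

/-- The disc formed by a star of polygons. -/
abbrev starDisc (k m : ℕ) [NeZero k] : Disc where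
  toSphereMap := starMap k m
  outer := orim 0 0

theorem starDisc_isInner {d : StarDart k m} : (starDisc k m).IsInner d ↔ d.face ≠ none :=
  not_congr ((Equiv.Perm.sameCycle_iff_of_invariant face_faceNext sameCycle_face).trans eq_comm)

theorem starMap_sameTail {d e : StarDart k m} :
    (starMap k m).SameTail d e ↔ d.tail = e.tail :=
  Equiv.Perm.sameCycle_iff_of_invariant tail_vertexNext sameCycle_tail

theorem starDisc_isInteriorVertex : (starDisc k m).IsInteriorVertex (out 0 : StarDart k m) := by
  intro e he
  have := starMap_sameTail.mp he
  rcases e with i | i | ⟨i, j⟩ | ⟨i, j⟩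
  · exact starDisc_isInner.mpr nofun
  · exact starDisc_isInner.mpr nofun
  · exact starDisc_isInner.mpr nofun
  · cases this

theorem starMap_degree : (starMap k m).degree (out 0 : StarDart k m) = k := by
  have : {e | (starMap k m).SameTail (out 0 : StarDart k m) e} = Set.range out := by
    ext e
    refine Iff.trans starMap_sameTail ?_
    constructor
    · intro h
      rcases e with i | i | ⟨i, j⟩ | ⟨i, j⟩
      · exact ⟨i, rfl⟩
      · cases h
      · simp only [tail] at h
        split_ifs at h
      · cases h
    · rintro ⟨i, rfl⟩
      rfl
  rw [SphereMap.degree, this, ← Nat.card_coe_set_eq, Nat.card_range_of_injective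
    (fun i j h => by cases h; rfl), Nat.card_zmod]

end Graphical

/-! ### Stars of immersed cycles as reduced disc diagrams. -/

namespace Graphical

section

variable {V W : Type*} {Ω : SimpleGraph W} {Θ : SimpleGraph V} {f : Ω →g Θ}

/-- Immersed cycles through lifts of a vertex `v`, arranged cyclically such that the first edge of
each one has the same image as the last edge of the following one, but is a different lift. -/
structure StarData (f : Ω →g Θ) (v : V) (k m : ℕ) where
  γ : ZMod k → ℕ → W
  immersed : ∀ i, IsPeriodicImmersion Ω (γ i) (m + 3)
  center : ∀ i, f (γ i 0) = v
  spoke : ∀ i, f (γ i 1) = f (γ (i + 1) (m + 2))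
  ne : ∀ i, [γ i 0, γ i 1] ≠ [γ (i + 1) 0, γ (i + 1) (m + 2)]

namespace StarData

open StarDart

variable {v : V} {k m : ℕ} (S : StarData f v k m)

/-- The image of the tail of a dart. -/
def vert : StarDart k m → V
  | out _ => v
  | inn i => f (S.γ i (m + 2))
  | rim i j => f (S.γ i (j + 1))
  | orim i j => f (S.γ i (j + 2))

/-- The lift of the tail of a dart on the boundary of a polygon. -/
def lift : StarDart k m → W
  | out i => S.γ i 0
  | inn i => S.γ i (m + 2)
  | rim i j => S.γ i (j + 1)
  | orim i j => S.γ i (j + 2)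

theorem vert_vertexNext (d : StarDart k m) : S.vert (vertexNext d) = S.vert d := by
  rcases d with i | i | ⟨i, j⟩ | ⟨i, j⟩
  · rfl
  · have := S.spoke (i - 1)
    rw [sub_add_cancel] at this
    exact this
  · rw [vertexNext_rim]
    by_cases h : (j : ℕ) = 0
    · rw [faceNext_orim_of_eq h]
      simp only [vert, h]
      exact (S.spoke i).symm
    · rw [faceNext_orim_of_ne h]
      change f (S.γ i ((j : ℕ) - 1 + 2)) = f (S.γ i (j + 1))
      rw [show (j : ℕ) - 1 + 2 = j + 1 by omega]
  · rw [vertexNext_orim]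
    by_cases h : (j : ℕ) < m
    · rw [faceNext_rim_of_lt h]; rfl
    · rw [faceNext_rim_of_eq (by omega)]
      simp only [vert]
      congr 3
      omega

/-- Reduces the conditions on boundaries of cells to those on `γ`; the position wraps around by
periodicity, `m + 2` being the last one before the centre. -/
theorem exists_pos {d : StarDart k m} (hd : d.face ≠ none) : ∃ i p, S.lift d = S.γ i p ∧
    S.lift (faceNext d) = S.γ i (p + 1) ∧ S.lift (faceNext (faceNext d)) = S.γ i (p + 2) := by
  have hN : ∀ i p, S.γ i (p + (m + 3)) = S.γ i p := fun i => (S.immersed i).period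
  have hrim : ∀ (i : ZMod k) (j : Fin (m + 1)), S.lift (faceNext (rim i j)) = S.γ i (j + 2) := by
    intro i j
    by_cases h : (j : ℕ) < m
    · rw [faceNext_rim_of_lt h]; rfl
    · rw [faceNext_rim_of_eq (by omega)]
      simp only [lift]
      congr 2
      omega
  rcases d with i | i | ⟨i, j⟩ | ⟨i, j⟩
  · exact ⟨i, 0, rfl, rfl, hrim i 0⟩
  · exact ⟨i, m + 2, rfl, (hN i 0).symm.trans (by rw [Nat.zero_add]),
      (hN i 1).symm.trans (by rw [Nat.add_comm])⟩
  · refine ⟨i, j + 1, rfl, hrim i j, ?_⟩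
    by_cases h : (j : ℕ) < m
    · rw [faceNext_rim_of_lt h, hrim]
    · obtain h : (j : ℕ) = m := by omega
      rw [faceNext_rim_of_eq h, h]
      exact (hN i 0).symm.trans (by rw [Nat.zero_add])
  · exact (hd rfl).elim

variable [NeZero k]

/-- The disc diagram formed by a star of immersed cycles. -/
def diagram : DiscDiagram f where
  toDisc := starDisc k m
  vert := S.vert
  vert_eq _ _ h := h.map_eq S.vert_vertexNext
  adj := by
    have hadj : ∀ i p, Θ.Adj (f (S.γ i p)) (f (S.γ i (p + 1))) := fun i p =>
      f.map_adj ((S.immersed i).adj p)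
    have h0 : ∀ i, Θ.Adj v (f (S.γ i 1)) := fun i => by
      have := hadj i 0
      rwa [S.center] at this
    rintro (i | i | ⟨i, j⟩ | ⟨i, j⟩)
    · have := h0 i
      rwa [S.spoke] at this
    · have := h0 (i - 1)
      rw [S.spoke, sub_add_cancel] at this
      exact this.symm
    · exact hadj i (j + 1)
    · exact (hadj i (j + 1)).symm
  lift c := S.lift c.1
  f_lift := by
    rintro ⟨i | i | i | i, hc⟩
    · exact S.center i
    · rfl
    · rfl
    · rfl
  lift_adj := by
    rintro ⟨d, hd⟩
    obtain ⟨i, p, h0, h1, -⟩ := S.exists_pos (starDisc_isInner.mp hd)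
    change Ω.Adj (S.lift d) (S.lift (faceNext d))
    rw [h0, h1]
    exact (S.immersed i).adj p
  lift_immersed := by
    rintro ⟨d, hd⟩
    obtain ⟨i, p, h0, -, h2⟩ := S.exists_pos (starDisc_isInner.mp hd)
    change S.lift d ≠ S.lift (faceNext (faceNext d))
    rw [h0, h2]
    exact (S.immersed i).ne p

theorem f_lift_source (x : (starDisc k m).Step) :
    f (S.lift x.source.1) = S.vert (x.dart : StarDart k m) := by
  obtain ⟨c, b⟩ := x
  cases b
  · refine (S.diagram.f_lift (Disc.cornerNext _ c)).trans ?_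
    have := S.vert_vertexNext (rev c.1)
    have h : rev (rev c.1 : StarDart k m) = c.1 := (starMap k m).rev_rev c.1
    rw [Equiv.Perm.mul_apply, h] at this
    exact this
  · exact S.diagram.f_lift c

theorem f_lift_target (x : (starDisc k m).Step) :
    f (S.lift x.target.1) = S.vert (rev x.dart : StarDart k m) := by
  obtain ⟨c, b⟩ := x
  have h : rev (rev c.1 : StarDart k m) = c.1 := (starMap k m).rev_rev c.1
  cases b
  · refine (S.diagram.f_lift c).trans ?_
    exact congrArg S.vert h.symm
  · refine (S.diagram.f_lift (Disc.cornerNext _ c)).trans ?_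
    have := S.vert_vertexNext (rev c.1)
    rw [Equiv.Perm.mul_apply, h] at this
    exact this

theorem lift_adj_step (x : (starDisc k m).Step) :
    Ω.Adj (S.lift x.source.1) (S.lift x.target.1) := by
  obtain ⟨c, b⟩ := x
  cases b
  · exact (S.diagram.lift_adj c).symm
  · exact S.diagram.lift_adj c

end StarData

open StarDart

variable {k m : ℕ} [NeZero k]

/-- The two factorizations of an edge at the centre of a star through the adjacent polygons. -/
inductive Opposite : (starDisc k m).Step → (starDisc k m).Step → Prop
  | outInn (i : ZMod k) (h h') : Opposite (⟨out i, h⟩, true) (⟨inn (i + 1), h'⟩, false)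
  | innOut (i : ZMod k) (h h') : Opposite (⟨inn (i + 1), h⟩, true) (⟨out i, h'⟩, false)

theorem Opposite.of_ne {x y : (starDisc k m).Step} (h : x.dart = y.dart) (hxy : x ≠ y) :
    Opposite x y ∨ Opposite y x := by
  have key : ∀ c c' : (starDisc k m).Corner, c.1 = rev c'.1 →
      Opposite (c, true) (c', false) := by
    rintro ⟨d, hd⟩ ⟨d', hd'⟩ h
    change d = rev d' at h
    rcases d' with i | i | ⟨i, j⟩ | ⟨i, j⟩
    · subst h
      exact .innOut i _ _
    · obtain ⟨i, rfl⟩ : ∃ j, i = j + 1 := ⟨i - 1, (sub_add_cancel i 1).symm⟩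
      obtain rfl : d = StarDart.out i := h.trans (by rw [rev_inn, add_sub_cancel_right])
      exact .outInn i _ _
    · subst h
      exact (starDisc_isInner.mp hd rfl).elim
    · exact (starDisc_isInner.mp hd' rfl).elim
  obtain ⟨c, b⟩ := x
  obtain ⟨c', b'⟩ := y
  cases b <;> cases b'
  · exact (hxy (Prod.ext (Subtype.ext (rev.injective h)) rfl)).elim
  · exact .inr (key c' c h.symm)
  · exact .inl (key c c' h)
  · exact (hxy (Prod.ext (Subtype.ext h) rfl)).elim

theorem Opposite.source_ne (hk : 3 ≤ k) {x y : (starDisc k m).Step} (h : Opposite x y) :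
    x.source ≠ y.source := by
  have h1 : ∀ i : ZMod k, i ≠ i + 1 := fun i h => by
    have : ((1 : ℕ) : ZMod k) = 0 := by simpa using h
    rw [ZMod.natCast_eq_zero_iff] at this
    exact absurd (Nat.le_of_dvd one_pos this) (by omega)
  intro h'
  have h' := congrArg Subtype.val h'
  cases h with
  | outInn i => exact h1 i (StarDart.out.inj h')
  | innOut i => cases h'

/-- A path with at least two edges has at most one factorization. -/
theorem Opposite.not_continue (hk : 3 ≤ k) {x y x' y' : (starDisc k m).Step} (h : Opposite x y)
    (hx : x.target = x'.source) (hy : y.target = y'.source) (hxy : x'.dart = y'.dart)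
    (hne : x'.dart ≠ rev x.dart) : False := by
  -- Here three polygons are needed: for `k = 2` both polygons would contain the path through the
  -- centre along the two spokes.
  have h2 : ∀ i : ZMod k, i + 1 ≠ i - 1 := fun i h => by
    have : ((2 : ℕ) : ZMod k) = 0 := by
      have : i + 1 - (i - 1) = 0 := by rw [h, sub_self]
      rw [← this]; push_cast; ring
    rw [ZMod.natCast_eq_zero_iff] at this
    exact absurd (Nat.le_of_dvd two_pos this) (by omega)
  have h1 : ∀ i : ZMod k, i ≠ i + 1 := fun i h => by
    have : ((1 : ℕ) : ZMod k) = 0 := by simpa using h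
    rw [ZMod.natCast_eq_zero_iff] at this
    exact absurd (Nat.le_of_dvd one_pos this) (by omega)
  have hx := congrArg Subtype.val hx
  have hy := congrArg Subtype.val hy
  have hnext : ∀ c d : StarDart k m, faceNext d = faceNext c → c = d :=
    fun c d h => (faceNext.injective h).symm
  obtain ⟨⟨c, hc⟩, b⟩ := x'
  obtain ⟨⟨c', hc'⟩, b'⟩ := y'
  cases h with
  | outInn i =>
    cases b
    · have : c = out i := hnext _ _ hx
      subst this
      exact hne rfl
    · obtain rfl : rim i 0 = c := hx
      cases b'
      · have : rev c' = rim i 0 := hxy.symm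
        have : c' = orim i 0 := by rw [← rev_rim, ← this]; exact ((starMap k m).rev_rev c').symm
        subst this
        exact starDisc_isInner.mp hc' rfl
      · obtain rfl : rim i 0 = c' := hxy
        cases hy
  | innOut i =>
    cases b
    · have : c = inn (i + 1) := hnext _ _ hx
      subst this
      exact hne rfl
    · obtain rfl : out (i + 1) = c := hx
      cases b'
      · have : c' = inn i := hnext _ _ hy
        subst this
        exact h2 i (StarDart.out.inj hxy)
      · obtain rfl : out i = c' := hy
        exact h1 i (StarDart.out.inj hxy).symm

/-- Different steps over one dart are opposite and so have different sources. Hence a factorization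
is determined by its first step. -/
theorem eq_of_isChain (hk : 3 ≤ k) {x : (starDisc k m).Step} {l l' : List (starDisc k m).Step}
    (h : (x :: l).IsChain fun x y => x.target = y.source)
    (h' : (x :: l').IsChain fun x y => x.target = y.source)
    (hl : l.map Disc.Step.dart = l'.map Disc.Step.dart) : l = l' := by
  induction l generalizing x l' with
  | nil =>
    cases l' with
    | nil => rfl
    | cons => cases hl
  | cons y l ih =>
    cases l' with
    | nil => cases hl
    | cons y' l' =>
      rw [List.isChain_cons_cons] at h h'
      rw [List.map_cons, List.map_cons, List.cons.injEq] at hl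
      have hs := h.1.symm.trans h'.1
      obtain rfl : y = y' := by
        by_contra hne
        rcases Opposite.of_ne hl.1 hne with h | h
        · exact h.source_ne hk hs
        · exact h.source_ne hk hs.symm
      rw [ih h.2 h'.2 hl.2]

/-- Distinct factorizations differ in their first step, which is then a spoke seen from its two
sides, and `Opposite.not_continue` rules out a second edge. -/
theorem exists_opposite (hk : 3 ≤ k) {l : List (starDisc k m).Dart} (hl : l ≠ [])
    (hi : (starDisc k m).IsImmersedPath l) {m₁ m₂ : List (starDisc k m).Step}
    (h₁ : (starDisc k m).IsLift l m₁) (h₂ : (starDisc k m).IsLift l m₂) (hne : m₁ ≠ m₂) :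
    ∃ x y : (starDisc k m).Step, l = [x.dart] ∧ m₁ = [x] ∧ m₂ = [y] ∧ x.dart = y.dart ∧
      (Opposite x y ∨ Opposite y x) := by
  obtain ⟨c₁, rfl⟩ := h₁
  obtain ⟨c₂, h₂⟩ := h₂
  cases m₁ with
  | nil => exact (hl rfl).elim
  | cons x m₁ =>
    cases m₂ with
    | nil => cases h₂
    | cons y m₂ =>
      rw [List.map_cons, List.map_cons, List.cons.injEq] at h₂
      have hxy : x ≠ y := by
        rintro rfl
        exact hne (by rw [eq_of_isChain hk c₁ c₂ h₂.2.symm])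
      have hopp := Opposite.of_ne h₂.1.symm hxy
      cases m₁ with
      | nil =>
        cases m₂ with
        | nil => exact ⟨x, y, rfl, rfl, rfl, h₂.1.symm, hopp⟩
        | cons => cases h₂.2
      | cons x' m₁ =>
        cases m₂ with
        | nil => cases h₂.2
        | cons y' m₂ =>
          rw [List.isChain_cons_cons] at c₁ c₂
          rw [List.map_cons, List.map_cons, List.cons.injEq] at h₂
          rw [Disc.IsImmersedPath, List.map_cons, List.map_cons, List.isChain_cons_cons] at hi
          rcases hopp with h | h
          · exact (h.not_continue hk c₁.1 c₂.1 h₂.2.1.symm hi.1.2).elim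
          · exact (h.not_continue hk c₂.1 c₁.1 h₂.2.1 (by rw [h₂.1, h₂.2.1]; exact hi.1.2)).elim

namespace StarData

variable {v : V} (S : StarData f v k m)

theorem lift_ne {x y : (starDisc k m).Step} (h : Opposite x y) :
    [S.lift x.source.1, S.lift x.target.1] ≠ [S.lift y.source.1, S.lift y.target.1] := by
  cases h with
  | outInn i => exact S.ne i
  | innOut i =>
    intro h
    change [S.γ (i + 1) (m + 2), S.γ (i + 1) 0] = [S.γ i 1, S.γ i 0] at h
    rw [List.cons.injEq, List.cons.injEq] at h
    exact S.ne i (by rw [h.1, h.2.1])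

/-- By `exists_opposite` the only pieces to test are single spokes, whose two lifts differ by the
field `ne`. -/
theorem diagram_isReduced (hk : 3 ≤ k) : S.diagram.IsReduced := by
  intro l hl hi m₁ m₂ h₁ h₂ hne
  obtain ⟨x, y, rfl, rfl, rfl, hxy, hopp⟩ := exists_opposite hk hl hi h₁ h₂ hne
  have hmap : ∀ x : (starDisc k m).Step, [f (S.lift x.source.1), f (S.lift x.target.1)] =
      [S.vert (x.dart : StarDart k m), S.vert (rev x.dart : StarDart k m)] := fun x => by
    rw [S.f_lift_source, S.f_lift_target]
  exact
    { nontrivial := le_rfl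
      isPath := List.isChain_pair.mpr (S.diagram.adj _)
      immersed := fun i h => absurd h (by simp [vertexList])
      isPath₁ := List.isChain_pair.mpr (S.lift_adj_step x)
      isPath₂ := List.isChain_pair.mpr (S.lift_adj_step y)
      map₁ := hmap x
      map₂ := (hmap y).trans (by rw [← hxy]; rfl)
      ne := hopp.elim (fun h => S.lift_ne h) fun h => (S.lift_ne h).symm }

end StarData

/-- The condition `T(6)` excludes stars of three, four or five immersed cycles. -/
theorem SatisfiesT.isEmpty_starData {q : ℕ} (hT : SatisfiesT f q) (v : V) (hk : 3 ≤ k)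
    (hq : k < q) : IsEmpty (StarData f v k m) :=
  ⟨fun S => hT S.diagram (S.diagram_isReduced hk) (out 0 : StarDart k m)
    starDisc_isInteriorVertex (by
      rw [show S.diagram.degree (out 0 : StarDart k m) = k from starMap_degree]
      exact ⟨hk, hq⟩)⟩

end

end Graphical

/-! ### Links of the thickening under `T(6)`. -/

namespace Graphical

open TriSystem

section Links

variable {V W : Type*} {Ω : SimpleGraph W} {Θ : SimpleGraph V} {f : Ω →g Θ}

theorem IsPeriodicImmersion.period_mul {γ : ℕ → W} {N : ℕ} (h : IsPeriodicImmersion Ω γ N)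
    (k i : ℕ) : γ (i + N * k) = γ i := by
  induction k with
  | zero => rfl
  | succ k ih => rw [Nat.mul_succ, ← Nat.add_assoc, h.period, ih]

/-- Immersed cycles may be traversed repeatedly, so the polygons of a star can all be given the same
length. -/
theorem IsPeriodicImmersion.of_dvd {γ : ℕ → W} {n m : ℕ} (h : IsPeriodicImmersion Ω γ (n + 1))
    (hd : n + 1 ∣ m + 3) : IsPeriodicImmersion Ω γ (m + 3) ∧ γ (m + 2) = γ n := by
  obtain ⟨k, hk⟩ := hd
  refine ⟨⟨by omega, h.adj, h.ne, fun i => hk ▸ h.period_mul k i⟩, ?_⟩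
  obtain ⟨k, rfl⟩ : ∃ j, k = j + 1 :=
    Nat.exists_eq_succ_of_ne_zero (by rintro rfl; simp at hk)
  rw [show m + 2 = n + (n + 1) * k by rw [Nat.mul_succ] at hk; omega, h.period_mul]

/-- Under `T(6)`, a graphical complex contains no star of three, four or five corners whose
successive members are different lifts of a common edge. -/
theorem SatisfiesT.not_star (hT : SatisfiesT f 6)
    (hΩ : ∀ e ∈ Ω.edgeSet, ∃ (w : W) (c : Ω.Walk w w), IsImmersedCycle c ∧ e ∈ c.edges)
    {k : ℕ} (hk : 3 ≤ k) (hk' : k < 6) {v : V} {w y z : ZMod k → W} (hy : ∀ i, Ω.Adj (w i) (y i))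
    (hz : ∀ i, Ω.Adj (w i) (z i)) (hyz : ∀ i, y i ≠ z i) (hw : ∀ i, f (w i) = v)
    (hf : ∀ i, f (z i) = f (y (i + 1)))
    (hne : ∀ i, [w i, z i] ≠ [w (i + 1), y (i + 1)]) : False := by
  have : NeZero k := ⟨by omega⟩
  choose γ n hγ h0 h1 hn using fun i => exists_immersion hΩ (hy i) (hz i) (hyz i)
  have hpos : 0 < ∏ i, (n i + 1) := Finset.prod_pos fun i _ => Nat.succ_pos _
  -- A common multiple of all cycle lengths; the factor 3 makes it at least 3.
  obtain ⟨m, hm⟩ : ∃ m, m + 3 = 3 * ∏ i, (n i + 1) := ⟨3 * ∏ i, (n i + 1) - 3, by omega⟩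
  have hd : ∀ i, n i + 1 ∣ m + 3 := fun i =>
    hm ▸ (Finset.dvd_prod_of_mem _ (Finset.mem_univ i)).mul_left 3
  have hlast : ∀ i, γ i (m + 2) = y i := fun i => ((hγ i).of_dvd (hd i)).2.trans (hn i)
  refine (hT.isEmpty_starData (k := k) (m := m) v hk hk').false
    ⟨γ, fun i => ((hγ i).of_dvd (hd i)).1, fun i => ?_, fun i => ?_, fun i => ?_⟩
  · rw [h0, hw]
  · rw [h1, hlast, hf]
  · rw [h0, h1, h0, hlast]
    exact hne i

/-- The darts of the thickening: oriented edges of `Θ`, and pairs of distinct vertices of a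
component of `Ω` which are not adjacent. -/
inductive ThickDart (Ω : SimpleGraph W) (Θ : SimpleGraph V)
  | edge (u v : V) (h : Θ.Adj u v)
  | diag (x y : W) (h : Ω.Reachable x y) (hne : x ≠ y) (hna : ¬ Ω.Adj x y)

namespace ThickDart

/-- The tail of a dart of the thickening. -/
def src (f : Ω →g Θ) : ThickDart Ω Θ → V
  | edge u _ _ => u
  | diag x _ _ _ _ => f x

/-- The head of a dart of the thickening. -/
def tgt (f : Ω →g Θ) : ThickDart Ω Θ → V
  | edge _ v _ => v
  | diag _ y _ _ _ => f y

/-- The inverse of a dart of the thickening. -/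
def rev : ThickDart Ω Θ → ThickDart Ω Θ
  | edge u v h => edge v u h.symm
  | diag x y h hne hna => diag y x h.symm hne.symm fun h => hna h.symm

end ThickDart

/-- `Joins f x y a`: the dart `a` of the thickening is given by the vertices `x` and `y` of a
component of `Ω`. -/
inductive Joins (f : Ω →g Θ) : W → W → ThickDart Ω Θ → Prop
  | edge {x y} (h : Ω.Adj x y) : Joins f x y (.edge (f x) (f y) (f.map_adj h))
  | diag {x y} (h : Ω.Reachable x y) (hne : x ≠ y) (hna : ¬ Ω.Adj x y) :
      Joins f x y (.diag x y h hne hna)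

namespace Joins

variable {x x' y z : W} {a b : ThickDart Ω Θ}

theorem exists_of_reachable (f : Ω →g Θ) (h : Ω.Reachable x y) (hne : x ≠ y) :
    ∃ a, Joins f x y a := by
  by_cases hxy : Ω.Adj x y
  · exact ⟨_, .edge hxy⟩
  · exact ⟨_, .diag h hne hxy⟩

theorem reachable (h : Joins f x y a) : Ω.Reachable x y := by
  cases h with
  | edge h => exact h.reachable
  | diag h => exact h

theorem ne (h : Joins f x y a) : x ≠ y := by
  cases h with
  | edge h => exact h.ne
  | diag _ hne => exact hne

theorem src_eq (h : Joins f x y a) : a.src f = f x := by cases h <;> rfl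

theorem tgt_eq (h : Joins f x y a) : a.tgt f = f y := by cases h <;> rfl

theorem rev (h : Joins f x y a) : Joins f y x a.rev := by
  cases h with
  | edge h => exact .edge h.symm
  | diag h hne hna => exact .diag h.symm _ _

theorem unique (h : Joins f x y a) (h' : Joins f x y b) : a = b := by
  cases h with
  | edge h =>
    cases h' with
    | edge => rfl
    | diag _ _ hna => exact (hna h).elim
  | diag _ _ hna =>
    cases h' with
    | edge h => exact (hna h).elim
    | diag => rfl

/-- A diagonal remembers its ends in `Ω`, so only edges of `Θ` can be carried by two different
lifts. -/
theorem adj_of_ne {y' : W} (h : Joins f x y a) (h' : Joins f x' y' a) (hne : x ≠ x') :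
    Ω.Adj x y ∧ Ω.Adj x' y' := by
  cases h with
  | edge h =>
    refine ⟨h, ?_⟩
    generalize hb : ThickDart.edge (f x) (f y) (f.map_adj h) = b at h'
    cases h' with
    | edge h' => exact h'
    | diag => cases hb
  | diag =>
    cases h' with
    | diag => exact (hne rfl).elim

end Joins

/-- The dart `a` is given by the vertex `x` and another vertex of its component. -/
def Carries (f : Ω →g Θ) (x : W) (a : ThickDart Ω Θ) : Prop := ∃ y, Joins f x y a

/-- The attaching maps are immersions. -/
theorem SatisfiesT.eq_of_adj (hT : SatisfiesT f 6)
    (hΩ : ∀ e ∈ Ω.edgeSet, ∃ (w : W) (c : Ω.Walk w w), IsImmersedCycle c ∧ e ∈ c.edges)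
    {x y z : W} (hy : Ω.Adj x y) (hz : Ω.Adj x z) (h : f y = f z) : y = z := by
  by_contra hne
  -- As `f y = f z`, three copies of the corner `y, x, z` close up to a star.
  exact hT.not_star hΩ (k := 3) le_rfl (by omega) (w := fun _ => x) (y := fun _ => y)
    (z := fun _ => z) (fun _ => hy) (fun _ => hz) (fun _ => hne) (fun _ => rfl) (fun _ => h.symm)
    (fun _ h => hne (by simpa using h.symm))

theorem SatisfiesT.eq_of_joins (hT : SatisfiesT f 6)
    (hΩ : ∀ e ∈ Ω.edgeSet, ∃ (w : W) (c : Ω.Walk w w), IsImmersedCycle c ∧ e ∈ c.edges)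
    {x y z : W} {a : ThickDart Ω Θ} (hy : Joins f x y a) (hz : Joins f x z a) : y = z := by
  have htgt := hy.tgt_eq.symm.trans hz.tgt_eq
  generalize hb : a = b at hz
  cases hy with
  | edge hy =>
    cases hz with
    | edge hz => exact hT.eq_of_adj hΩ hy hz htgt
    | diag => cases hb
  | diag =>
    cases hz with
    | edge => cases hb
    | diag => cases hb; rfl

theorem Carries.link {x : W} {a b : ThickDart Ω Θ} (ha : Carries f x a) (hb : Carries f x b)
    (hab : a ≠ b) : ∃ c x y z, Joins f x y a ∧ Joins f x z b ∧ Joins f y z c := by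
  obtain ⟨y, hy⟩ := ha
  obtain ⟨z, hz⟩ := hb
  obtain ⟨c, hc⟩ := Joins.exists_of_reachable f (hy.reachable.symm.trans hz.reachable)
    (by rintro rfl; exact hab (hy.unique hz))
  exact ⟨c, x, y, z, hy, hz, hc⟩

/-- Since `x i` and `x (i + 1)` differ, the dart `a (i + 1)` they share is an edge of `Θ`. The
corners of `Ω` at `x i` between its lifts of `a i` and `a (i + 1)` form a forbidden star. -/
theorem SatisfiesT.not_cycle (hT : SatisfiesT f 6)
    (hΩ : ∀ e ∈ Ω.edgeSet, ∃ (w : W) (c : Ω.Walk w w), IsImmersedCycle c ∧ e ∈ c.edges)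
    {k : ℕ} (hk : 3 ≤ k) (hk' : k < 6) {x : ZMod k → W} {a : ZMod k → ThickDart Ω Θ}
    (h₁ : ∀ i, Carries f (x i) (a i)) (h₂ : ∀ i, Carries f (x i) (a (i + 1)))
    (ha : ∀ i, a i ≠ a (i + 1)) (hx : ∀ i, x i ≠ x (i + 1)) : False := by
  have : NeZero k := ⟨by omega⟩
  choose y hy using h₁
  choose z hz using h₂
  have hadj := fun i => (hz i).adj_of_ne (hy (i + 1)) (hx i)
  refine hT.not_star hΩ hk hk' (v := f (x 0)) (w := x) (y := y) (z := z) (fun i => ?_)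
    (fun i => (hadj i).1) (fun i h => ha i ?_) (StarDart.induct_zmod rfl fun i hi => ?_)
    (fun i => ?_) fun i h => hx i (List.cons.inj h).1
  · have := (hadj (i - 1)).2
    rwa [sub_add_cancel] at this
  · exact (h ▸ hy i).unique (hz i)
  · rw [← hi, ← (hz i).src_eq, (hy (i + 1)).src_eq]
  · rw [← (hz i).tgt_eq, (hy (i + 1)).tgt_eq]

/-- Two lifts of a vertex have at most one common edge. -/
theorem SatisfiesT.carries_unique (hT : SatisfiesT f 6)
    (hΩ : ∀ e ∈ Ω.edgeSet, ∃ (w : W) (c : Ω.Walk w w), IsImmersedCycle c ∧ e ∈ c.edges)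
    {x x' : W} {a b : ThickDart Ω Θ} (hab : a ≠ b) (ha : Carries f x a)
    (hb : Carries f x b) (ha' : Carries f x' a) (hb' : Carries f x' b) : x = x' := by
  by_contra hne
  refine hT.not_cycle hΩ (k := 4) (by omega) (by omega) (x := ![x, x', x, x']) (a := ![a, b, a, b])
    ?_ ?_ ?_ ?_
  · exact Fin.forall_fin_succ.mpr ⟨ha, Fin.forall_fin_succ.mpr ⟨hb', Fin.forall_fin_succ.mpr
      ⟨ha, Fin.forall_fin_one.mpr hb'⟩⟩⟩
  · exact Fin.forall_fin_succ.mpr ⟨hb, Fin.forall_fin_succ.mpr ⟨ha', Fin.forall_fin_succ.mpr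
      ⟨hb, Fin.forall_fin_one.mpr ha'⟩⟩⟩
  · exact Fin.forall_fin_succ.mpr ⟨hab, Fin.forall_fin_succ.mpr ⟨hab.symm, Fin.forall_fin_succ.mpr
      ⟨hab, Fin.forall_fin_one.mpr hab.symm⟩⟩⟩
  · exact Fin.forall_fin_succ.mpr ⟨hne, Fin.forall_fin_succ.mpr ⟨Ne.symm hne,
      Fin.forall_fin_succ.mpr ⟨hne, Fin.forall_fin_one.mpr (Ne.symm hne)⟩⟩⟩

/-- A Helly property, which yields `tetra`: three different lifts would form a star of three
corners, and if two coincide, `SatisfiesT.carries_unique` identifies the third. -/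
theorem SatisfiesT.carries_three (hT : SatisfiesT f 6)
    (hΩ : ∀ e ∈ Ω.edgeSet, ∃ (w : W) (c : Ω.Walk w w), IsImmersedCycle c ∧ e ∈ c.edges)
    {x y z : W} {a b c : ThickDart Ω Θ} (hab : a ≠ b) (hbc : b ≠ c) (hca : c ≠ a)
    (hxa : Carries f x a) (hxb : Carries f x b) (hyb : Carries f y b) (hyc : Carries f y c)
    (hzc : Carries f z c) (hza : Carries f z a) : x = y ∧ y = z := by
  by_cases hxy : x = y
  · subst hxy
    exact ⟨rfl, hT.carries_unique hΩ hca hyc hxa hzc hza⟩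
  by_cases hyz : y = z
  · subst hyz
    exact ⟨hT.carries_unique hΩ hab hxa hxb hza hyb, rfl⟩
  by_cases hzx : z = x
  · subst hzx
    exact (hxy (hT.carries_unique hΩ hbc hxb hzc hyb hyc)).elim
  refine (hT.not_cycle hΩ (k := 3) le_rfl (by omega) (x := ![x, y, z]) (a := ![a, b, c])
    ?_ ?_ ?_ ?_).elim
  · exact Fin.forall_fin_succ.mpr ⟨hxa, Fin.forall_fin_succ.mpr ⟨hyb, Fin.forall_fin_one.mpr hzc⟩⟩
  · exact Fin.forall_fin_succ.mpr ⟨hxb, Fin.forall_fin_succ.mpr ⟨hyc, Fin.forall_fin_one.mpr hza⟩⟩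
  · exact Fin.forall_fin_succ.mpr ⟨hab, Fin.forall_fin_succ.mpr ⟨hbc, Fin.forall_fin_one.mpr hca⟩⟩
  · exact Fin.forall_fin_succ.mpr ⟨hxy, Fin.forall_fin_succ.mpr ⟨hyz, Fin.forall_fin_one.mpr hzx⟩⟩

/-- The darts `a` and `b` belong to a triangle of the thickening. -/
abbrev Linked (f : Ω →g Θ) (a b : ThickDart Ω Θ) : Prop :=
  ∃ c x y z, Joins f x y a ∧ Joins f x z b ∧ Joins f y z c

theorem Linked.carries (hT : SatisfiesT f 6)
    (hΩ : ∀ e ∈ Ω.edgeSet, ∃ (w : W) (c : Ω.Walk w w), IsImmersedCycle c ∧ e ∈ c.edges)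
    {a b : ThickDart Ω Θ} (h : Linked f a b) : a ≠ b ∧ ∃ x, Carries f x a ∧ Carries f x b := by
  obtain ⟨c, x, y, z, ha, hb, hc⟩ := h
  refine ⟨?_, x, ⟨y, ha⟩, z, hb⟩
  rintro rfl
  exact hc.ne (hT.eq_of_joins hΩ ha hb)

/-- The darts and triangles of the thickening. -/
def thickSystem (hT : SatisfiesT f 6)
    (hΩ : ∀ e ∈ Ω.edgeSet, ∃ (w : W) (c : Ω.Walk w w), IsImmersedCycle c ∧ e ∈ c.edges) :
    TriSystem V (ThickDart Ω Θ) where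
  src := ThickDart.src f
  tgt := ThickDart.tgt f
  rev := ThickDart.rev
  L a b c := ∃ x y z, Joins f x y a ∧ Joins f x z b ∧ Joins f y z c
  rev_rev a := by cases a <;> rfl
  src_rev a := by cases a <;> rfl
  src_left := fun ⟨x, y, z, ha, hb, hc⟩ => by rw [ha.src_eq, hb.src_eq]
  src_third := fun ⟨x, y, z, ha, hb, hc⟩ => by rw [hc.src_eq, ha.tgt_eq]
  tgt_third := fun ⟨x, y, z, ha, hb, hc⟩ => by rw [hc.tgt_eq, hb.tgt_eq]
  swap := fun ⟨x, y, z, ha, hb, hc⟩ => ⟨x, z, y, hb, ha, hc.rev⟩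
  rot := fun ⟨x, y, z, ha, hb, hc⟩ => ⟨y, x, z, ha.rev, hc, hb⟩
  unique := by
    rintro a b c c' ⟨x, y, z, ha, hb, hc⟩ ⟨x', y', z', ha', hb', hc'⟩
    obtain rfl := hT.carries_unique hΩ
      (by rintro rfl; exact hc.ne (hT.eq_of_joins hΩ ha hb)) ⟨y, ha⟩ ⟨z, hb⟩ ⟨y', ha'⟩ ⟨z', hb'⟩
    obtain rfl := hT.eq_of_joins hΩ ha ha'
    obtain rfl := hT.eq_of_joins hΩ hb hb'
    exact hc.unique hc'
  irrefl := fun ⟨x, y, z, ha, hb, hc⟩ => hc.ne (hT.eq_of_joins hΩ ha hb)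
  tetra := by
    rintro a b b' c c' d h₁ h₂ h₃
    have n₁ := (Linked.carries hT hΩ ⟨_, h₁⟩).1
    have n₂ := (Linked.carries hT hΩ ⟨_, h₂⟩).1
    have n₃ := (Linked.carries hT hΩ ⟨_, h₃⟩).1
    obtain ⟨x, y, z, ha, hb, hc⟩ := h₁
    obtain ⟨x', y', z', ha', hb', hc'⟩ := h₂
    obtain ⟨x'', y'', z'', ha'', hb'', hc''⟩ := h₃
    obtain ⟨rfl, rfl⟩ := hT.carries_three hΩ n₁ n₃ n₂.symm ⟨_, ha⟩ ⟨_, hb⟩ ⟨_, ha''⟩ ⟨_, hb''⟩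
      ⟨_, hb'⟩ ⟨_, ha'⟩
    obtain rfl := hT.eq_of_joins hΩ ha ha'
    obtain rfl := hT.eq_of_joins hΩ hb ha''
    obtain rfl := hT.eq_of_joins hΩ hb' hb''
    exact ⟨_, _, _, hc, hc', hc''⟩
  four := by
    intro a b c d h₁ h₂ h₃ h₄ hac hbd
    obtain ⟨n₁, x₁, k₁, l₁⟩ := Linked.carries hT hΩ h₁
    obtain ⟨n₂, x₂, k₂, l₂⟩ := Linked.carries hT hΩ h₂
    obtain ⟨n₃, x₃, k₃, l₃⟩ := Linked.carries hT hΩ h₃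
    obtain ⟨n₄, x₄, k₄, l₄⟩ := Linked.carries hT hΩ h₄
    -- If two successive lifts coincide, that lift carries both ends of a diagonal, which is then a
    -- chord. Otherwise the four lifts contradict `SatisfiesT.not_cycle`.
    by_contra hcon
    rw [not_or] at hcon
    refine hT.not_cycle hΩ (k := 4) (by omega) (by omega) (x := ![x₁, x₂, x₃, x₄])
      (a := ![a, b, c, d]) ?_ ?_ ?_ ?_
    · exact Fin.forall_fin_succ.mpr ⟨k₁, Fin.forall_fin_succ.mpr ⟨k₂, Fin.forall_fin_succ.mpr
        ⟨k₃, Fin.forall_fin_one.mpr k₄⟩⟩⟩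
    · exact Fin.forall_fin_succ.mpr ⟨l₁, Fin.forall_fin_succ.mpr ⟨l₂, Fin.forall_fin_succ.mpr
        ⟨l₃, Fin.forall_fin_one.mpr l₄⟩⟩⟩
    · exact Fin.forall_fin_succ.mpr ⟨n₁, Fin.forall_fin_succ.mpr ⟨n₂, Fin.forall_fin_succ.mpr
        ⟨n₃, Fin.forall_fin_one.mpr n₄⟩⟩⟩
    · exact Fin.forall_fin_succ.mpr ⟨fun h : x₁ = x₂ => hcon.1 (k₁.link (h ▸ l₂) hac),
        Fin.forall_fin_succ.mpr ⟨fun h : x₂ = x₃ => hcon.2 (k₂.link (h ▸ l₃) hbd),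
        Fin.forall_fin_succ.mpr ⟨fun h : x₃ = x₄ => hcon.1 ((h ▸ l₄ : Carries f x₃ a).link k₃ hac),
        Fin.forall_fin_one.mpr fun h : x₄ = x₁ => hcon.2 ((h ▸ l₁ : Carries f x₄ b).link k₄ hbd)⟩⟩⟩
  five := by
    intro a b c d e h₁ h₂ h₃ h₄ h₅ hac had hbd hbe hce
    obtain ⟨n₁, x₁, k₁, l₁⟩ := Linked.carries hT hΩ h₁
    obtain ⟨n₂, x₂, k₂, l₂⟩ := Linked.carries hT hΩ h₂
    obtain ⟨n₃, x₃, k₃, l₃⟩ := Linked.carries hT hΩ h₃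
    obtain ⟨n₄, x₄, k₄, l₄⟩ := Linked.carries hT hΩ h₄
    obtain ⟨n₅, x₅, k₅, l₅⟩ := Linked.carries hT hΩ h₅
    by_contra hcon
    rw [not_or, not_or, not_or, not_or] at hcon
    obtain ⟨c₁, c₂, c₃, c₄, c₅⟩ := hcon
    refine hT.not_cycle hΩ (k := 5) (by omega) (by omega) (x := ![x₁, x₂, x₃, x₄, x₅])
      (a := ![a, b, c, d, e]) ?_ ?_ ?_ ?_
    · exact Fin.forall_fin_succ.mpr ⟨k₁, Fin.forall_fin_succ.mpr ⟨k₂, Fin.forall_fin_succ.mpr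
        ⟨k₃, Fin.forall_fin_succ.mpr ⟨k₄, Fin.forall_fin_one.mpr k₅⟩⟩⟩⟩
    · exact Fin.forall_fin_succ.mpr ⟨l₁, Fin.forall_fin_succ.mpr ⟨l₂, Fin.forall_fin_succ.mpr
        ⟨l₃, Fin.forall_fin_succ.mpr ⟨l₄, Fin.forall_fin_one.mpr l₅⟩⟩⟩⟩
    · exact Fin.forall_fin_succ.mpr ⟨n₁, Fin.forall_fin_succ.mpr ⟨n₂, Fin.forall_fin_succ.mpr
        ⟨n₃, Fin.forall_fin_succ.mpr ⟨n₄, Fin.forall_fin_one.mpr n₅⟩⟩⟩⟩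
    · exact Fin.forall_fin_succ.mpr ⟨fun h : x₁ = x₂ => c₁ (k₁.link (h ▸ l₂) hac),
        Fin.forall_fin_succ.mpr ⟨fun h : x₂ = x₃ => c₃ (k₂.link (h ▸ l₃) hbd),
        Fin.forall_fin_succ.mpr ⟨fun h : x₃ = x₄ => c₅ (k₃.link (h ▸ l₄) hce),
        Fin.forall_fin_succ.mpr ⟨fun h : x₄ = x₅ => c₂ ((h ▸ l₅ : Carries f x₄ a).link k₄ had),
        Fin.forall_fin_one.mpr fun h : x₅ = x₁ => c₄ ((h ▸ l₁ : Carries f x₅ b).link k₅ hbe)⟩⟩⟩⟩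

end Links

end Graphical

/-! ### Lifting walks and homotopies to the universal cover. -/

namespace Graphical

open TriSystem

section Lifting

variable {V W : Type*} {Ω : SimpleGraph W} {Θ : SimpleGraph V} {f : Ω →g Θ} {hT : SatisfiesT f 6}
  {hΩ : ∀ e ∈ Ω.edgeSet, ∃ (w : W) (c : Ω.Walk w w), IsImmersedCycle c ∧ e ∈ c.edges} {o : V}

/-- The walk `p` lifts to a walk from `x` to `y` in the universal cover. -/
def LiftsTo : ∀ {u v : V}, Θ.Walk u v → (thickSystem hT hΩ).Cover o →
    (thickSystem hT hΩ).Cover o → Prop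
  | _, _, .nil, x, y => x = y
  | _, _, .cons h p, x, y => ∃ z, (thickSystem hT hΩ).CoverEdge x (.edge _ _ h) z ∧ LiftsTo p z y

namespace LiftsTo

variable {x y z : (thickSystem hT hΩ).Cover o} {u v t : V}

theorem proj_eq {p : Θ.Walk u v} (h : LiftsTo p x y) (hx : x.proj = u) : y.proj = v := by
  induction p generalizing x with
  | nil => exact h ▸ hx
  | cons _ p ih =>
    obtain ⟨z, hz, h⟩ := h
    exact ih h hz.tgt_eq.symm

theorem exists_lift (p : Θ.Walk u v) (hx : x.proj = u) : ∃ y, LiftsTo p x y := by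
  induction p generalizing x with
  | nil => exact ⟨x, rfl⟩
  | cons h p ih =>
    obtain ⟨z, hz⟩ := CoverEdge.exists_of_src_eq (a := ThickDart.edge _ _ h) x hx.symm
    obtain ⟨y, hy⟩ := ih hz.tgt_eq.symm
    exact ⟨y, z, hz, hy⟩

theorem unique {p : Θ.Walk u v} (h : LiftsTo p x y) (h' : LiftsTo p x z) : y = z := by
  induction p generalizing x with
  | nil => exact h.symm.trans h'
  | cons _ p ih =>
    obtain ⟨s, hs, h⟩ := h
    obtain ⟨s', hs', h'⟩ := h'
    obtain rfl := hs.unique hs'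
    exact ih h h'

theorem append_iff {p : Θ.Walk u v} {q : Θ.Walk v t} :
    LiftsTo (p.append q) x z ↔ ∃ y, LiftsTo p x y ∧ LiftsTo q y z := by
  induction p generalizing x with
  | nil => exact ⟨fun h => ⟨x, rfl, h⟩, fun ⟨y, hy, h⟩ => hy ▸ h⟩
  | cons _ p ih =>
    constructor
    · rintro ⟨s, hs, h⟩
      obtain ⟨y, hy, h⟩ := ih.mp h
      exact ⟨y, ⟨s, hs, hy⟩, h⟩
    · rintro ⟨y, ⟨s, hs, hy⟩, h⟩
      exact ⟨s, hs, ih.mpr ⟨y, hy, h⟩⟩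

theorem reverse {p : Θ.Walk u v} (h : LiftsTo p x y) : LiftsTo p.reverse y x := by
  induction p generalizing x with
  | nil => exact h.symm
  | cons _ p ih =>
    obtain ⟨s, hs, h⟩ := h
    rw [SimpleGraph.Walk.reverse_cons, append_iff]
    exact ⟨s, ih h, x, hs.symm, rfl⟩

/-- Walks in `Ω` lift to cliques of the universal cover. -/
theorem of_component {a b : W} {c : Ω.Walk a b} (h : LiftsTo (c.map f) x y) :
    (a = b → x = y) ∧ ∀ d, Joins f a b d → (thickSystem hT hΩ).CoverEdge x d y := by
  induction c generalizing x with
  | nil => exact ⟨fun _ => h, fun d hd => (hd.ne rfl).elim⟩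
  | @cons a a' b haa' c ih =>
    obtain ⟨z, hz, h⟩ := h
    obtain ⟨h₁, h₂⟩ := ih h
    have hz' : (thickSystem hT hΩ).CoverEdge z _ x := hz.symm
    have hj : Joins f a' a (.edge (f a') (f a) (f.map_adj haa').symm) := (Joins.edge haa').rev
    refine ⟨?_, fun d hd => ?_⟩
    · rintro rfl
      exact hz'.unique (h₂ _ hj)
    -- For three distinct vertices, the rest of the walk lifts to the dart from `a'` to `b`, and the
    -- triangle on `a'`, `a`, `b` lifts.
    · by_cases hb : a' = b
      · subst hb
        rw [← h₁ rfl, hd.unique (.edge haa')]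
        exact hz
      · obtain ⟨d', hd'⟩ := Joins.exists_of_reachable f c.reachable hb
        exact hz'.third (h₂ d' hd') ⟨a', a, b, hj, hd', hd⟩

/-- Backtrackings lift to backtrackings, and the boundary of a 2-cell is the image of a closed walk
of `Ω`, which lifts to a closed walk by `of_component`. -/
theorem iff_of_homotopic {p q : Θ.Walk u v} (h : Homotopic f p q) (hx : x.proj = u) :
    LiftsTo p x y ↔ LiftsTo q x y := by
  induction h generalizing x with
  | refl => rfl
  | symm _ ih => exact (ih hx).symm
  | trans _ _ ih ih' => exact (ih hx).trans (ih' hx)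
  | backtrack p h q =>
    rw [append_iff, append_iff]
    constructor
    · rintro ⟨s, hs, s', hs', s'', hs'', h'⟩
      have : (thickSystem hT hΩ).CoverEdge s' _ s := hs'.symm
      exact ⟨s, hs, (hs''.unique this) ▸ h'⟩
    · rintro ⟨s, hs, h'⟩
      obtain ⟨s', hs'⟩ := CoverEdge.exists_of_src_eq (a := ThickDart.edge _ _ h) s
        (hs.proj_eq hx).symm
      exact ⟨s, hs, s', hs', s, hs'.symm, h'⟩
  | cell c hc p q =>
    rw [append_iff, append_iff]
    refine exists_congr fun s => and_congr_right fun hs => ?_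
    rw [append_iff]
    constructor
    · rintro ⟨s', hs', h⟩
      exact (of_component hs').1 rfl ▸ h
    · intro h
      obtain ⟨s', hs'⟩ := exists_lift (c.map f) (hs.proj_eq hx)
      exact ⟨s', hs', (of_component hs').1 rfl ▸ h⟩

/-- A diagonal is replaced by the image of a walk of `Ω` between its ends, so that points of the
cover can be reached by walks in `Θ`, the only ones to which simple connectivity applies. -/
theorem exists_of_dart (d : ThickDart Ω Θ) : ∃ p : Θ.Walk (d.src f) (d.tgt f),
    ∀ x y : (thickSystem hT hΩ).Cover o, (thickSystem hT hΩ).CoverEdge x d y → LiftsTo p x y := by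
  cases d with
  | edge u v h => exact ⟨.cons h .nil, fun x y hxy => ⟨y, hxy, rfl⟩⟩
  | diag a b hab hne hna =>
    obtain ⟨c⟩ := hab
    refine ⟨c.map f, fun x y hxy => ?_⟩
    obtain ⟨z, hz⟩ := exists_lift (c.map f) hxy.src_eq.symm
    rwa [hxy.unique ((of_component hz).2 _ (.diag ⟨c⟩ hne hna))]

theorem exists_walk (x : (thickSystem hT hΩ).Cover o) :
    ∃ (v : V) (p : Θ.Walk o v), LiftsTo p ⟨0, PUnit.unit⟩ x := by
  obtain ⟨n, w⟩ := x
  induction n with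
  | zero => exact ⟨o, .nil, rfl⟩
  | succ n ih =>
    obtain ⟨w', d, h⟩ := Sphere.exists_up w
    obtain ⟨v, p, hp⟩ := ih w'
    obtain ⟨q, hq⟩ := exists_of_dart (hT := hT) (hΩ := hΩ) (o := o) d
    have h := CoverEdge.up h
    obtain rfl : d.src f = v := h.src_eq.trans (hp.proj_eq rfl)
    exact ⟨_, p.append q, append_iff.mpr ⟨_, hp, hq _ _ h⟩⟩

end LiftsTo

/-- Reach both points from the root by lifts of walks `p` and `q`. The loop `p` followed by the
reverse of `q` is null-homotopic, so its lift closes up, and unique lifting of `q` identifies the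
points. -/
theorem SimplyConnected.coversInjectively (hsc : SimplyConnected f) :
    (thickSystem hT hΩ).CoversInjectively := by
  intro o x y hxy
  obtain ⟨u, p, hp⟩ := LiftsTo.exists_walk x
  obtain ⟨v, q, hq⟩ := LiftsTo.exists_walk y
  have hpx := hp.proj_eq rfl
  obtain rfl : u = v := by rw [← hpx, hxy, hq.proj_eq rfl]
  obtain ⟨z, hz⟩ := LiftsTo.exists_lift q.reverse hpx
  have := (LiftsTo.iff_of_homotopic (hsc.2 o (p.append q.reverse)) rfl).mp
    (LiftsTo.append_iff.mpr ⟨x, hp, hz⟩)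
  obtain rfl : _ = z := this
  have := hz.reverse
  rw [SimpleGraph.Walk.reverse_reverse] at this
  exact this.unique hq

end Lifting

/-! ### The thickening is systolic. -/

section

variable {V W : Type*} {Ω : SimpleGraph W} {Θ : SimpleGraph V} (f : Ω →g Θ)

theorem oneSkeleton_flagCompletion {V : Type*} (G : SimpleGraph V) :
    oneSkeleton (flagCompletion G) = G := by
  classical
  ext u v
  constructor
  · rintro ⟨hne, s, hs, hu, hv⟩
    exact hs.2 hu hv hne
  · intro h
    refine ⟨h.ne, {u, v}, ⟨by simp, ?_⟩, by simp, by simp⟩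
    rw [Finset.coe_pair, SimpleGraph.isClique_pair]
    exact fun _ => h

theorem isSkeleton_thickGraph (hT : SatisfiesT f 6)
    (hΩ : ∀ e ∈ Ω.edgeSet, ∃ (w : W) (c : Ω.Walk w w), IsImmersedCycle c ∧ e ∈ c.edges) :
    (thickSystem hT hΩ).IsSkeleton (thickGraph f) := by
  intro u v
  refine and_congr_right fun hne => ⟨?_, ?_⟩
  · rintro (h | ⟨x, y, hxy, rfl, rfl⟩)
    · exact ⟨.edge u v h, rfl, rfl⟩
    · obtain ⟨a, ha⟩ := Joins.exists_of_reachable f hxy (by rintro rfl; exact hne rfl)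
      exact ⟨a, ha.src_eq, ha.tgt_eq⟩
  · rintro ⟨a, rfl, rfl⟩
    cases a with
    | edge u v h => exact .inl h
    | diag x y h => exact .inr ⟨x, y, h, rfl, rfl⟩

end

end Graphical

theorem mainTheorem10 {V W : Type*} (Ω : SimpleGraph W) (Θ : SimpleGraph V)
    (hΘ : Θ.Connected) (hdeg : ∀ v, ¬ ∃! u, Θ.Adj v u) (f : Ω →g Θ)
    (hΩ : ∀ e ∈ Ω.edgeSet, ∃ (w : W) (c : Ω.Walk w w), Graphical.IsImmersedCycle c ∧ e ∈ c.edges)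
    (hsc : Graphical.SimplyConnected f)
    (hC : Graphical.SatisfiesC f 3) (hT : Graphical.SatisfiesT f 6) :
    IsSystolic (Graphical.thickening f) := by
  have hG := Graphical.oneSkeleton_flagCompletion (Graphical.thickGraph f)
  refine ⟨fun s hs h => ⟨hs, hG ▸ h⟩, ?_⟩
  rw [Graphical.thickening, hG]
  exact (hsc.coversInjectively (hT := hT) (hΩ := hΩ)).isBridged
    (Graphical.isSkeleton_thickGraph f hT hΩ)
    (hΘ.mono fun u v h => ⟨h.ne, .inl h⟩)
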